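/- Let $(X,d)$ be a complete separable metric space, $\mathfrak m\ge 0$ a Borel measure on $X$ that is finite on bounded sets, and $q\in(1,\infty]$. Let $\pi$ be a plan on $X$, i.e. a finite non-negative Borel measure on $C([0,1];X)$ (with the topology of uniform convergence) concentrated on rectifiable curves. For a rectifiable curve $\gamma$ let $s_\gamma$ be its total variation measure, i.e. the Lebesgue--Stieltjes measure on $[0,1]$ of $t\mapsto\ell(\gamma|_{[0,t]})$, and for a continuous function $\theta:[0,1]\to\mathbb R$ of bounded variation let $\mu_\theta$ be the signed Borel measure on $[0,1]$ with $\mu_\theta([a,b])=\theta(b)-\theta(a)$ for all $a\le b$. Assume that $\pi$ has barycenter in $L^q(\mathfrak m)$, i.e. $\Pi_\pi:=\int\gamma_\#s_\gamma\,d\pi(\gamma)\ll\mathfrak m$ and $\mathrm{Bar}(\pi):=\frac{d\Pi_\pi}{d\mathfrak m}\in L^q(\mathfrak m)$. Let $\mathrm{LIP}_{bs}(X)$ be the algebra of real Lipschitz functions on $X$ with bounded support, and let $\mathrm{lip}_a(f)(x)=\inf_{r>0}\mathrm{Lip}(f;B_r(x))$ be the asymptotic slope ($0$ at isolated points). Let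 $\mathrm{Der}^q(X)$ be the space of linear maps $b:\mathrm{LIP}_{bs}(X)\to L^q(\mathfrak m)$ such that $b(fg)=f\,b(g)+g\,b(f)$ for all $f,g$, and such that for some non-negative $G\in L^q(\mathfrak m)$ one has $$|b(f)|\le G\,\mathrm{lip}_a(f)\quad\mathfrak m\text{-a.e., for every }f\in\mathrm{LIP}_{bs}(X).\qquad(*)$$ The pointwise norm $|b|$ is the infimum in $L^q(\mathfrak m)$ of all non-negative $G\in L^q(\mathfrak m)$ satisfying $(*)$. Let $\mathrm{Der}^q_{\mathfrak M}(X)$ be the set of those $b\in\mathrm{Der}^q(X)$ for which there is a signed Borel measure $\mathbf{div}(b)$, defined and real-valued on bounded Borel sets and whose trace on every bounded Borel set is a finite signed measure, such that $\int b(f)\,d\mathfrak m=-\int f\,d\,\mathbf{div}(b)$ for every $f\in\mathrm{LIP}_{bs}(X)$ (such a measure is unique). Then there is a unique $b_\pi\in\mathrm{Der}^q_{\mathfrak M}(X)$ such that $$\int g\,b_\pi(f)\,d\mathfrak m=\int\!\!\int g\circ\gamma\,d\mu_{f\circ\gamma}\,d\pi(\gamma)\quad\text{for every }(f,g)\in\mathrm{LIP}_{bs}(X)\times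 L^\infty(\mathfrak m),$$ where the iterated integral on the right-hand side converges absolutely: $g\circ\gamma\in L^1(|\mu_{f\circ\gamma}|)$ for $\pi$-a.e. $\gamma$, and $\gamma\mapsto\int g\circ\gamma\,d\mu_{f\circ\gamma}$ is $\pi$-integrable. Moreover, $|b_\pi|\le\mathrm{Bar}(\pi)$ $\mathfrak m$-a.e. and $\mathbf{div}(b_\pi)=(e_0)_\#\pi-(e_1)_\#\pi$, where $e_t(\gamma)=\gamma_t$. -/

import Mathlib

open MeasureTheory Set
open scoped ENNReal NNReal unitInterval

noncomputable section

namespace MetricMeasure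

/-! ### Curves and the measures they induce -/

section Curves

variable {X : Type*} [MetricSpace X]

/-- A curve `γ : [0,1] → X` is rectifiable if it is continuous (bundled) and its length, the
supremum of its variations along partitions, is finite. -/
def Rectifiable (γ : C(I, X)) : Prop := eVariationOn γ univ < ∞

/-- `arcLength γ t` is the length of `γ` restricted to `[0,t]` (relevant for rectifiable `γ`). -/
def arcLength (γ : C(I, X)) (t : I) : ℝ := (eVariationOn γ (Icc 0 t)).toReal

theorem Rectifiable.monotone_arcLength {γ : C(I, X)} (h : Rectifiable γ) :
    Monotone (arcLength γ) := fun _ _ hst =>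
  ENNReal.toReal_mono (ne_top_of_le_ne_top h.ne (eVariationOn.mono _ (subset_univ _)))
    (eVariationOn.mono _ (Icc_subset_Icc_right hst))

open scoped Classical in
/-- The total variation measure `s_γ` of a rectifiable curve: the Lebesgue-Stieltjes measure on
`[0,1]` of its arc length function (which is continuous). Set to `0` for other curves. -/
def lengthMeasure (γ : C(I, X)) : Measure I :=
  if h : Rectifiable γ then h.monotone_arcLength.stieltjesFunction.measure else 0

open scoped Classical in
/-- The signed variation `μ_θ` of a function `θ : [0,1] → ℝ` of bounded variation. For continuous
`θ` it is the signed Borel measure with `μ_θ [a,b] = θ b - θ a` whenever `a ≤ b`. -/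
def signedVariation (θ : I → ℝ) : SignedMeasure I :=
  if h : BoundedVariationOn θ univ then h.vectorMeasure else 0

end Curves

/-! ### Plans and barycenters -/

section Plans

variable {X : Type*} [MetricSpace X] [MeasurableSpace X] [MeasurableSpace C(I, X)]

/-- A plan: a finite Borel measure on `C([0,1]; X)` concentrated on rectifiable curves. -/
def IsPlan (π : Measure C(I, X)) [IsFiniteMeasure π] : Prop := ∀ᵐ γ ∂π, Rectifiable γ

/-- The measure `Π_π = ∫ γ_# s_γ dπ(γ)` on `X`. -/
def curveMeasure (π : Measure C(I, X)) : Measure X :=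
  π.bind fun γ => (lengthMeasure γ).map γ

/-- The density `Bar(π) = dΠ_π / dm`. -/
def bar (π : Measure C(I, X)) (m : Measure X) : X → ℝ≥0∞ := (curveMeasure π).rnDeriv m

/-- `π` has barycenter in `L^q(m)`. -/
structure HasBarycenter (π : Measure C(I, X)) (m : Measure X) (q : ℝ≥0∞) : Prop where
  absolutelyContinuous : curveMeasure π ≪ m
  memLp : eLpNorm (bar π m) q m < ∞

end Plans

/-! ### Lipschitz functions with bounded support and their asymptotic slope -/

section Lipschitz

/-- The algebra `LIP_bs(X)` of real Lipschitz functions with bounded support. -/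
def LIPbs (X : Type*) [MetricSpace X] : NonUnitalSubalgebra ℝ (X → ℝ) where
  carrier := {f | (∃ K, LipschitzWith K f) ∧ Bornology.IsBounded (Function.support f)}
  add_mem' := by
    rintro f g ⟨⟨K, hf⟩, hfb⟩ ⟨⟨L, hg⟩, hgb⟩
    exact ⟨⟨_, hf.add hg⟩, (hfb.union hgb).subset (Function.support_add f g)⟩
  zero_mem' := ⟨⟨0, LipschitzWith.const 0⟩, by simp⟩
  mul_mem' := by
    rintro f g ⟨⟨K, hf⟩, hfb⟩ ⟨⟨L, hg⟩, hgb⟩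
    have key : ∀ (f : X → ℝ) (K : ℝ≥0), LipschitzWith K f →
        Bornology.IsBounded (Function.support f) → ∃ M : ℝ≥0, ∀ x, |f x| ≤ M := by
      intro f K hf hb
      obtain ⟨C, hC⟩ := (hf.isBounded_image hb).exists_norm_le
      refine ⟨C.toNNReal, fun x => ?_⟩
      by_cases hx : f x = 0
      · simp [hx]
      · exact (hC _ ⟨x, hx, rfl⟩).trans (Real.le_coe_toNNReal C)
    obtain ⟨A, hA⟩ := key f K hf hfb
    obtain ⟨B, hB⟩ := key g L hg hgb
    refine ⟨⟨A * L + B * K, LipschitzWith.of_dist_le_mul fun x y => ?_⟩,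
      hfb.subset fun x hx => left_ne_zero_of_mul hx⟩
    have h1 := hf.dist_le_mul x y
    have h2 := hg.dist_le_mul x y
    rw [Real.dist_eq] at h1 h2 ⊢
    have e : (f * g) x - (f * g) y = f x * (g x - g y) + g y * (f x - f y) := by
      simp only [Pi.mul_apply]; ring
    rw [e]
    calc |f x * (g x - g y) + g y * (f x - f y)|
        ≤ |f x| * |g x - g y| + |g y| * |f x - f y| := by
          rw [← abs_mul, ← abs_mul]; exact abs_add_le _ _
      _ ≤ A * (L * dist x y) + B * (K * dist x y) :=
          add_le_add (mul_le_mul (hA x) h2 (abs_nonneg _) A.2)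
            (mul_le_mul (hB y) h1 (abs_nonneg _) B.2)
      _ = _ := by push_cast; ring
  smul_mem' := by
    rintro c f ⟨⟨K, hf⟩, hfb⟩
    refine ⟨⟨‖c‖₊ * K, LipschitzWith.of_dist_le_mul fun x y => ?_⟩,
      hfb.subset fun x hx => right_ne_zero_of_mul hx⟩
    have h1 := hf.dist_le_mul x y
    rw [Real.dist_eq] at h1 ⊢
    simp only [Pi.smul_apply, smul_eq_mul, ← mul_sub, abs_mul, NNReal.coe_mul, coe_nnnorm,
      Real.norm_eq_abs, mul_assoc]
    exact mul_le_mul_of_nonneg_left h1 (abs_nonneg c)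

variable {X : Type*} [MetricSpace X]

/-- `Lip(f; E)`, for Lipschitz `f` (with value `0` if `E` has at most one point). -/
def lipConst (f : X → ℝ) (E : Set X) : ℝ :=
  sSup {c | ∃ y ∈ E, ∃ z ∈ E, y ≠ z ∧ c = |f y - f z| / dist y z}

/-- The asymptotic slope `lip_a(f)(x) = inf_{r > 0} Lip(f; B_r(x))` of a Lipschitz function. At an
isolated point small balls are singletons, so the value there is `0`. -/
def asympSlope (f : X → ℝ) (x : X) : ℝ := ⨅ r : Ioi (0 : ℝ), lipConst f (Metric.ball x r)

end Lipschitz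

/-! ### Boundedly-finite signed measures -/

/-- A boundedly-finite signed Borel measure: a set function on the bounded Borel sets whose
trace on every bounded Borel set is a finite signed measure. Its values on other sets carry no
meaning and are normalised to `0`. -/
@[ext]
structure BoundedlyFiniteSignedMeasure (X : Type*) [MetricSpace X] [MeasurableSpace X] where
  toFun : Set X → ℝ
  toFun_of_not : ∀ B, ¬(MeasurableSet B ∧ Bornology.IsBounded B) → toFun B = 0
  exists_trace : ∀ B, MeasurableSet B ∧ Bornology.IsBounded B →
    ∃ ν : SignedMeasure X, ∀ E, MeasurableSet E → ν E = toFun (B ∩ E)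

namespace BoundedlyFiniteSignedMeasure

variable {X : Type*} [MetricSpace X] [MeasurableSpace X]

open scoped Classical in
/-- The trace `E ↦ μ (B ∩ E)` of `μ` on a bounded Borel set `B`. -/
def trace (μ : BoundedlyFiniteSignedMeasure X) (B : Set X) : SignedMeasure X :=
  if h : MeasurableSet B ∧ Bornology.IsBounded B then (μ.exists_trace B h).choose else 0

/-- The integral of a bounded Borel function with bounded support: it is computed with the trace
of `μ` on the closed support of `f`. -/
def integral (μ : BoundedlyFiniteSignedMeasure X) (f : X → ℝ) : ℝ :=
  ∫ᵛ x, f x ∂•(μ.trace (tsupport f))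

open scoped Classical in
/-- A finite signed measure seen as a boundedly-finite one. -/
def ofSignedMeasure (ν : SignedMeasure X) : BoundedlyFiniteSignedMeasure X where
  toFun B := if MeasurableSet B ∧ Bornology.IsBounded B then ν B else 0
  toFun_of_not B hB := if_neg hB
  exists_trace B hB := ⟨ν.restrict B, fun E hE => by
    rw [VectorMeasure.restrict_apply ν hB.1 hE, inter_comm,
      if_pos ⟨hB.1.inter hE, hB.2.subset inter_subset_left⟩]⟩

end BoundedlyFiniteSignedMeasure

/-! ### Lipschitz derivations -/

variable {X : Type*} [MetricSpace X] [MeasurableSpace X]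

/-- The space `Der^q(X)` of Lipschitz derivations `LIP_bs(X) → L^q(m)`, with the asymptotic slope
as gauge function. -/
@[ext]
structure LipDerivation (m : Measure X) (q : ℝ≥0∞) where
  toLinearMap : LIPbs X →ₗ[ℝ] Lp ℝ q m
  weak_locality : ∃ G : Lp ℝ q m, 0 ≤ G ∧
    ∀ f : LIPbs X, ∀ᵐ x ∂m, |toLinearMap f x| ≤ G x * asympSlope f x
  leibniz : ∀ f g : LIPbs X, ∀ᵐ x ∂m, toLinearMap (f * g) x =
    (f : X → ℝ) x * toLinearMap g x + (g : X → ℝ) x * toLinearMap f x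

namespace LipDerivation

variable {m : Measure X} {q : ℝ≥0∞}

/-- The functions `G ∈ L^q(m)^+` with `|b(f)| ≤ G lip_a(f)` `m`-a.e. for all `f ∈ LIP_bs(X)`. -/
def bounds (b : LipDerivation m q) : Set (Lp ℝ q m) :=
  {G | 0 ≤ G ∧ ∀ f : LIPbs X, ∀ᵐ x ∂m, |b.toLinearMap f x| ≤ G x * asympSlope f x}

/-- `N` is the pointwise norm `|b|`, the infimum of `b.bounds` in the ordered space `L^q(m)`. -/
def IsPointwiseNorm (b : LipDerivation m q) (N : Lp ℝ q m) : Prop := IsGLB b.bounds N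

/-- `ν` is a divergence of `b`: `∫ b(f) dm = -∫ f dν` for all `f ∈ LIP_bs(X)`. -/
def IsDivergence (b : LipDerivation m q) (ν : BoundedlyFiniteSignedMeasure X) : Prop :=
  ∀ f : LIPbs X, ∫ x, b.toLinearMap f x ∂m = -ν.integral f

end LipDerivation

/-- The space `Der^q_𝔐(X)` of Lipschitz derivations having a measure-valued divergence. -/
@[ext]
structure LipDerivationDiv (m : Measure X) (q : ℝ≥0∞) extends LipDerivation m q where
  exists_divergence : ∃ ν, toLipDerivation.IsDivergence ν

/-- The divergence `div(b)`. -/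
def LipDerivationDiv.div {m : Measure X} {q : ℝ≥0∞} (b : LipDerivationDiv m q) :
    BoundedlyFiniteSignedMeasure X := b.exists_divergence.choose

/-- The derivation `b` is induced by the plan `π`:
`∫ g b(f) dm = ∫ ∫ g ∘ γ dμ_{f ∘ γ} dπ(γ)` for all `f ∈ LIP_bs(X)` and `g ∈ L^∞(m)`. -/
def LipDerivationDiv.IsInducedBy [MeasurableSpace C(I, X)] {m : Measure X} {q : ℝ≥0∞}
    (b : LipDerivationDiv m q) (π : Measure C(I, X)) : Prop :=
  ∀ (f : LIPbs X) (g : X → ℝ), MemLp g ∞ m →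
    ∫ x, g x * b.toLinearMap f x ∂m =
      ∫ γ, (∫ᵛ t, g (γ t) ∂•(signedVariation fun t => (f : X → ℝ) (γ t))) ∂π

end MetricMeasure

end

noncomputable section

namespace MetricMeasure

open Filter Topology ProbabilityTheory

/-! ### Arc length, tilted Stieltjes measures and the signed variation along a curve. -/

section Curves

variable {X : Type*} [MetricSpace X]

/-! If `f` is `K`-Lipschitz then `|μ_{f∘γ}| ≤ K s_γ`. Averaging over `π`, the set function `A ↦ ∫
μ_{f∘γ}(γ⁻¹A) dπ` is dominated by `K Π_π ≪ m`, and its density with respect to `m` is `b_π(f)`.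

To work with positive measures only, `μ_{f∘γ}` is written as `(K s_γ + μ_{f∘γ}) - K s_γ`. The first
term, `tiltedMeasure`, is the Stieltjes measure of the increasing function `K ℓ + f∘γ`; its values
on `[0,t]` are measurable in `γ`, so it can be mixed over `π` and differentiated
(`integral_signedVariation_curve`, `exists_density`). Both mixtures are restricted to the support of
`f`, where they are finite.

The slope bound is local: on an open set where `f` is `L`-Lipschitz, `|μ_{f∘γ}| ≤ L s_γ`, so the
density is at most `L Bar(π)` there. Countably many balls turn this into `|b_π(f)| ≤ Bar(π)
lip_a(f)`.

The Leibniz rule follows from this bound and linearity alone (`leibniz_of_weak_locality`): `(f -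
c)(g - d)` has zero slope at `x` when `c = f x` and `d = g x`. Linearity and uniqueness come from
testing densities against bounded `g`. The divergence comes from `g = 1`, because `μ_{f∘γ}` has
total mass `f(γ₁) - f(γ₀)`, and it is unique because Lipschitz functions approximate indicators of
closed sets. Finally `|b_π| ≤ Bar(π)` because `Bar(π)` is an admissible bound and the pointwise norm
is the least one (`exists_isLeast_bounds`). -/

theorem Rectifiable.arcLength_eq {γ : C(I, X)} (t : I) :
    arcLength γ t = variationOnFromTo γ univ 0 t := by
  rw [variationOnFromTo.eq_of_le _ _ unitInterval.nonneg', univ_inter]; rfl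

/-- Stieltjes functions are normalised by right limits; right continuity makes that normalisation
harmless. -/
theorem Rectifiable.continuousWithinAt_arcLength {γ : C(I, X)} (h : Rectifiable γ) (t : I) :
    ContinuousWithinAt (arcLength γ) (Ici t) t := by
  have hb : BoundedVariationOn γ univ := h.ne
  have := hb.continuousWithinAt_variationOnFromTo_Ici (a := 0)
    (x := t) γ.continuous.continuousWithinAt
  exact this.congr (fun s _ => arcLength_eq s) (arcLength_eq t)

theorem Rectifiable.dist_le_arcLength_sub {γ : C(I, X)} (h : Rectifiable γ) {s t : I}
    (hst : s ≤ t) : dist (γ s) (γ t) ≤ arcLength γ t - arcLength γ s := by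
  have hb : BoundedVariationOn γ univ := h.ne
  rw [arcLength_eq, arcLength_eq, variationOnFromTo.sub_right hb.locallyBoundedVariationOn
    (mem_univ _) (mem_univ _) (mem_univ _), variationOnFromTo.eq_of_le _ _ hst, dist_edist]
  exact ENNReal.toReal_mono (hb.locallyBoundedVariationOn s t (mem_univ _) (mem_univ _))
    (eVariationOn.edist_le _ ⟨mem_univ _, le_rfl, hst⟩ ⟨mem_univ _, hst, le_rfl⟩)

theorem arcLength_zero (γ : C(I, X)) : arcLength γ 0 = 0 := by
  simp [arcLength, eVariationOn.subsingleton]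

theorem arcLength_nonneg (γ : C(I, X)) (t : I) : 0 ≤ arcLength γ t := ENNReal.toReal_nonneg

theorem Rectifiable.monotone_arcLength_add {γ : C(I, X)} (h : Rectifiable γ) {f : X → ℝ} {K : ℝ≥0}
    (hf : LipschitzWith K f) : Monotone fun t => K * arcLength γ t + f (γ t) := by
  intro s t hst
  have h1 := hf.dist_le_mul (γ s) (γ t)
  have h2 := mul_le_mul_of_nonneg_left (h.dist_le_arcLength_sub hst) K.2
  rw [Real.dist_eq] at h1
  have h3 := le_abs_self (f (γ s) - f (γ t))
  simp only [NNReal.val_eq_coe] at h2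
  dsimp only
  linarith

theorem Rectifiable.boundedVariationOn_comp {γ : C(I, X)} (h : Rectifiable γ) {f : X → ℝ}
    {K : ℝ≥0} (hf : LipschitzWith K f) : BoundedVariationOn (fun t => f (γ t)) univ :=
  hf.comp_boundedVariationOn (f := f) (g := γ) h.ne

theorem continuous_comp_curve {f : X → ℝ} {K : ℝ≥0} (hf : LipschitzWith K f) (γ : C(I, X)) :
    Continuous fun t => f (γ t) := hf.continuous.comp γ.continuous

theorem univ_eq_Icc_zero_one : (univ : Set I) = Icc 0 1 := by
  ext s; simp [unitInterval.le_one']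

theorem signedVariation_Icc {θ : I → ℝ} (hc : Continuous θ) (hb : BoundedVariationOn θ univ)
    {s t : I} (hst : s ≤ t) : signedVariation θ (Icc s t) = θ t - θ s := by
  rw [signedVariation, dif_pos hb, hb.vectorMeasure_Icc hst,
    hc.continuousWithinAt.rightLim_eq, hc.continuousWithinAt.leftLim_eq]

/-- The sets `[0,t] = Iic t` form a generating π-system, and `t = 1` gives the total mass. -/
theorem signedMeasure_ext_of_Icc {μ ν : SignedMeasure I}
    (h : ∀ t : I, μ (Icc 0 t) = ν (Icc 0 t)) : μ = ν := by
  have hI : ∀ t : I, Iic t = Icc 0 t := fun t => by ext s; simp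
  refine VectorMeasure.ext_of_generateFrom (range Iic) ?_
    ((BorelSpace.measurable_eq (α := I)).trans (borel_eq_generateFrom_Iic I)) isPiSystem_Iic ?_
  · rintro _ ⟨t, rfl⟩
    rw [hI, h]
  · rw [univ_eq_Icc_zero_one, h]

theorem stieltjesFunction_eq_of_continuousWithinAt {F : I → ℝ} (hF : Monotone F) {s : I}
    (hs : ContinuousWithinAt F (Ici s) s) : hF.stieltjesFunction s = F s := by
  rw [Monotone.stieltjesFunction_eq, hs.rightLim_eq]

open scoped Classical in
/-- The Lebesgue-Stieltjes measure of `t ↦ K * ℓ(γ|_[0,t]) + f (γ t)`, which is monotone when `f` is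
`K`-Lipschitz and `γ` is rectifiable. -/
def tiltedMeasure (f : X → ℝ) (K : ℝ≥0) (γ : C(I, X)) : Measure I :=
  if h : Rectifiable γ ∧ LipschitzWith K f then
    (h.1.monotone_arcLength_add h.2).stieltjesFunction.measure else 0

theorem Rectifiable.tiltedMeasure_Icc {γ : C(I, X)} (h : Rectifiable γ) {f : X → ℝ} {K : ℝ≥0}
    (hf : LipschitzWith K f) (t : I) : tiltedMeasure f K γ (Icc 0 t) =
      ENNReal.ofReal (K * arcLength γ t + (f (γ t) - f (γ 0))) := by
  have hr : ∀ s : I, (h.monotone_arcLength_add hf).stieltjesFunction s =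
      K * arcLength γ s + f (γ s) := by
    intro s
    refine stieltjesFunction_eq_of_continuousWithinAt _ ?_
    have h1 := h.continuousWithinAt_arcLength s
    have h2 := (continuous_comp_curve hf γ).continuousWithinAt (s := Ici s) (x := s)
    exact (continuousWithinAt_const.mul h1).add h2
  -- At a bottom point the left limit is by convention the value, so there is no atom at `0`.
  have hbot : IsBot (0 : I) := fun s => unitInterval.nonneg'
  rw [tiltedMeasure, dif_pos ⟨h, hf⟩, StieltjesFunction.measure_Icc, leftLim_eq_of_isBot hbot, hr,
    hr, arcLength_zero]
  congr 1; ring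

/-- Makes finiteness and measurability of `s_γ` special cases of those of the tilted measures. -/
theorem Rectifiable.tiltedMeasure_zero_one {γ : C(I, X)} (h : Rectifiable γ) :
    tiltedMeasure (0 : X → ℝ) 1 γ = lengthMeasure γ := by
  have h0 : LipschitzWith 1 (0 : X → ℝ) := LipschitzWith.const' 0
  rw [tiltedMeasure, dif_pos ⟨h, h0⟩, lengthMeasure, dif_pos h]
  congr 2
  funext t
  simp

instance (f : X → ℝ) (K : ℝ≥0) (γ : C(I, X)) : IsFiniteMeasure (tiltedMeasure f K γ) := by
  by_cases h : Rectifiable γ ∧ LipschitzWith K f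
  · refine ⟨?_⟩
    rw [univ_eq_Icc_zero_one, h.1.tiltedMeasure_Icc h.2]
    exact ENNReal.ofReal_lt_top
  · rw [tiltedMeasure, dif_neg h]
    infer_instance

instance (γ : C(I, X)) : IsFiniteMeasure (lengthMeasure γ) := by
  by_cases h : Rectifiable γ
  · rw [← h.tiltedMeasure_zero_one]
    infer_instance
  · rw [lengthMeasure, dif_neg h]
    infer_instance

theorem Rectifiable.lengthMeasure_Icc {γ : C(I, X)} (h : Rectifiable γ) (t : I) :
    lengthMeasure γ (Icc 0 t) = ENNReal.ofReal (arcLength γ t) := by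
  rw [← h.tiltedMeasure_zero_one, h.tiltedMeasure_Icc (f := 0) (LipschitzWith.const' 0)]
  simp

theorem Rectifiable.toSignedMeasure_tiltedMeasure {γ : C(I, X)} (h : Rectifiable γ) {f : X → ℝ}
    {K : ℝ≥0} (hf : LipschitzWith K f) : (tiltedMeasure f K γ).toSignedMeasure =
      (K : ℝ) • (lengthMeasure γ).toSignedMeasure + signedVariation fun t => f (γ t) := by
  refine signedMeasure_ext_of_Icc fun t => ?_
  have h0 : (0 : I) ≤ t := unitInterval.nonneg'
  have h1 := h.monotone_arcLength_add hf h0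
  simp only [arcLength_zero, mul_zero, zero_add] at h1
  rw [add_apply, smul_apply,
    Measure.toSignedMeasure_apply_measurable measurableSet_Icc,
    Measure.toSignedMeasure_apply_measurable measurableSet_Icc,
    signedVariation_Icc (continuous_comp_curve hf γ) (h.boundedVariationOn_comp hf) h0,
    measureReal_def, measureReal_def, h.tiltedMeasure_Icc hf, h.lengthMeasure_Icc,
    ENNReal.toReal_ofReal (by linarith), ENNReal.toReal_ofReal (arcLength_nonneg γ t), smul_eq_mul]

theorem Rectifiable.signedVariation_comp_eq {γ : C(I, X)} (h : Rectifiable γ) {f : X → ℝ}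
    {K : ℝ≥0} (hf : LipschitzWith K f) : signedVariation (fun t => f (γ t)) =
      (tiltedMeasure f K γ).toSignedMeasure - (K : ℝ) • (lengthMeasure γ).toSignedMeasure := by
  rw [h.toSignedMeasure_tiltedMeasure hf, add_sub_cancel_left]

theorem Rectifiable.neg_le_signedVariation_comp {γ : C(I, X)} (h : Rectifiable γ) {f : X → ℝ}
    {K : ℝ≥0} (hf : LipschitzWith K f) {A : Set I} (hA : MeasurableSet A) :
    -(K * (lengthMeasure γ).real A) ≤ signedVariation (fun t => f (γ t)) A := by
  rw [h.signedVariation_comp_eq hf, sub_apply, smul_apply,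
    Measure.toSignedMeasure_apply_measurable hA, Measure.toSignedMeasure_apply_measurable hA,
    smul_eq_mul]
  have := measureReal_nonneg (μ := tiltedMeasure f K γ) (s := A)
  linarith

theorem signedVariation_neg {θ : I → ℝ} (hc : Continuous θ) (hb : BoundedVariationOn θ univ)
    (hb' : BoundedVariationOn (fun t => -θ t) univ) :
    signedVariation (fun t => -θ t) = -signedVariation θ := by
  refine signedMeasure_ext_of_Icc fun t => ?_
  rw [neg_apply, signedVariation_Icc hc hb (unitInterval.nonneg' (t := t)),
    signedVariation_Icc (θ := fun t => -θ t) hc.neg hb' (unitInterval.nonneg' (t := t))]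
  ring

theorem signedVariation_add {θ η : I → ℝ} (hθc : Continuous θ) (hθ : BoundedVariationOn θ univ)
    (hηc : Continuous η) (hη : BoundedVariationOn η univ)
    (hb' : BoundedVariationOn (fun t => θ t + η t) univ) :
    signedVariation (fun t => θ t + η t) = signedVariation θ + signedVariation η := by
  refine signedMeasure_ext_of_Icc fun t => ?_
  rw [add_apply, signedVariation_Icc hθc hθ (unitInterval.nonneg' (t := t)),
    signedVariation_Icc hηc hη (unitInterval.nonneg' (t := t)),
    signedVariation_Icc (θ := fun t => θ t + η t) (hθc.add hηc) hb' (unitInterval.nonneg' (t := t))]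
  ring

theorem signedVariation_const_mul {θ : I → ℝ} (c : ℝ) (hc : Continuous θ)
    (hb : BoundedVariationOn θ univ) (hb' : BoundedVariationOn (fun t => c * θ t) univ) :
    signedVariation (fun t => c * θ t) = c • signedVariation θ := by
  refine signedMeasure_ext_of_Icc fun t => ?_
  rw [smul_apply, signedVariation_Icc hc hb (unitInterval.nonneg' (t := t)),
    signedVariation_Icc (hc.const_mul c) hb' (unitInterval.nonneg' (t := t)), smul_eq_mul]
  ring

/-- Positivity of the tilted measures of `f` and of `-f` bounds `μ_{f∘γ}` setwise from both sides,
and setwise bounds control the variation. -/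
theorem Rectifiable.variation_signedVariation_comp_le {γ : C(I, X)} (h : Rectifiable γ) {f : X → ℝ}
    {K : ℝ≥0} (hf : LipschitzWith K f) :
    (signedVariation fun t => f (γ t)).variation ≤ K • lengthMeasure γ := by
  refine VectorMeasure.variation_le_of_forall_enorm_le fun A hA => ?_
  have h1 := h.neg_le_signedVariation_comp hf hA
  have hf' : LipschitzWith K fun x => -f x := hf.neg
  have h2 := h.neg_le_signedVariation_comp hf' hA
  have hb := h.boundedVariationOn_comp hf'
  have h3 := signedVariation_neg (continuous_comp_curve hf γ) (h.boundedVariationOn_comp hf) hb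
  have h4 : (signedVariation fun t => -f (γ t)) A = -(signedVariation fun t => f (γ t)) A := by
    rw [h3, neg_apply]
  rw [Measure.smul_apply, Real.enorm_eq_ofReal_abs, ENNReal.smul_def, smul_eq_mul,
    ← ofReal_measureReal, ← ENNReal.ofReal_coe_nnreal, ← ENNReal.ofReal_mul K.coe_nonneg]
  refine ENNReal.ofReal_le_ofReal (abs_le.2 ⟨h1, ?_⟩)
  rw [h4] at h2
  linarith

theorem variation_signedVariation_eq_zero {θ : I → ℝ} (hc : Continuous θ)
    (hb : BoundedVariationOn θ univ) {V : Set I} (hV : IsOpen V) (h0 : ∀ t ∈ V, θ t = 0) :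
    (signedVariation θ).variation V = 0 := by
  refine measure_null_of_locally_null V fun t ht => ?_
  -- Each `[0,s] ∩ [a,b]` is empty or an interval with both endpoints in `V`, where `θ` vanishes.
  obtain ⟨a, b, htab, hnhds, hsub⟩ := exists_Icc_mem_subset_of_mem_nhds (hV.mem_nhds ht)
  refine ⟨Icc a b, mem_nhdsWithin_of_mem_nhds hnhds, ?_⟩
  have hr : (signedVariation θ).restrict (Icc a b) = 0 := by
    refine signedMeasure_ext_of_Icc fun s => ?_
    rw [VectorMeasure.restrict_apply _ measurableSet_Icc measurableSet_Icc, Icc_inter_Icc,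
      sup_eq_right.2 (unitInterval.nonneg' (t := a)), zero_apply]
    by_cases h : a ≤ s ⊓ b
    · rw [signedVariation_Icc hc hb h, h0 _ (hsub ⟨h, inf_le_right⟩),
        h0 _ (hsub ⟨le_rfl, h.trans inf_le_right⟩), sub_zero]
    · rw [Icc_eq_empty h, VectorMeasure.empty]
  rw [← Measure.restrict_apply_univ, ← VectorMeasure.variation_restrict measurableSet_Icc, hr]
  simp

/-- If `f` is Lipschitz with constant `L` on an open set `U`, then `|μ_{f ∘ γ}| ≤ L s_γ` on
`γ ⁻¹ U`. -/
theorem Rectifiable.variation_signedVariation_restrict_le {γ : C(I, X)} (h : Rectifiable γ)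
    {f : X → ℝ} {K L : ℝ≥0} (hf : LipschitzWith K f) {U : Set X} (hU : IsOpen U)
    (hfU : LipschitzOnWith L f U) :
    (signedVariation fun t => f (γ t)).variation.restrict (γ ⁻¹' U) ≤ L • lengthMeasure γ := by
  -- Extend `f|_U` to a globally `L`-Lipschitz `g`; as `f - g` vanishes on `U`, its signed variation
  -- does not charge `γ⁻¹ U`.
  obtain ⟨g, hg, hgf⟩ := hfU.extend_real
  have hsub : LipschitzWith (K + L) fun x => f x - g x := hf.sub hg
  have hbs := h.boundedVariationOn_comp hsub
  have hcs := continuous_comp_curve hsub γ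
  have hV := hU.preimage γ.continuous
  have he : (fun t => f (γ t)) = fun t => (f (γ t) - g (γ t)) + g (γ t) := by
    funext t; simp
  have hadd : (signedVariation fun t => f (γ t)) =
      (signedVariation fun t => (f (γ t) - g (γ t))) + signedVariation fun t => g (γ t) := by
    have hb := h.boundedVariationOn_comp hf
    rw [he] at hb
    rw [he]
    exact signedVariation_add hcs hbs
      (continuous_comp_curve hg γ) (h.boundedVariationOn_comp hg) hb
  have hz : (signedVariation fun t => (f (γ t) - g (γ t))).variation.restrict (γ ⁻¹' U) = 0 := by
    rw [Measure.restrict_eq_zero]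
    exact variation_signedVariation_eq_zero hcs hbs hV fun t ht => by
        rw [hgf ht, sub_self]
  calc _ ≤ ((signedVariation fun t => (f (γ t) - g (γ t))).variation +
        (signedVariation fun t => g (γ t)).variation).restrict (γ ⁻¹' U) := by
        rw [hadd]
        exact Measure.restrict_mono Subset.rfl VectorMeasure.variation_add_le
    _ = (signedVariation fun t => g (γ t)).variation.restrict (γ ⁻¹' U) := by
        rw [Measure.restrict_add, hz, zero_add]
    _ ≤ _ := Measure.restrict_le_self.trans (h.variation_signedVariation_comp_le hg)

end Curves

/-! ### Measurability in the curve, and mixtures over a plan. -/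

section Plans

variable {X : Type*} [MetricSpace X]

theorem integral_lsmul_toSignedMeasure {Ω : Type*} [MeasurableSpace Ω] {μ : Measure Ω}
    [IsFiniteMeasure μ] (f : Ω → ℝ) : ∫ᵛ x, f x ∂•μ.toSignedMeasure = ∫ x, f x ∂μ := by
  have h : ContinuousLinearMap.lsmul ℝ ℝ = (ContinuousLinearMap.lsmul ℝ ℝ (E := ℝ)).flip := by
    ext; simp
  rw [h, VectorMeasure.integral_toSignedMeasure]

theorem Rectifiable.tiltedMeasure_le {γ : C(I, X)} (h : Rectifiable γ) {f : X → ℝ}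
    {K : ℝ≥0} (hf : LipschitzWith K f) : tiltedMeasure f K γ ≤ (2 * K) • lengthMeasure γ := by
  refine Measure.le_intro fun A hA _ => ?_
  have hf' : LipschitzWith K fun x => -f x := hf.neg
  have h1 := congrArg (fun ν : SignedMeasure I => ν A) (h.toSignedMeasure_tiltedMeasure hf)
  have h2 := h.neg_le_signedVariation_comp hf' hA
  have hb := h.boundedVariationOn_comp hf'
  rw [signedVariation_neg (continuous_comp_curve hf γ) (h.boundedVariationOn_comp hf) hb,
    neg_apply] at h2
  simp only [add_apply, smul_apply, Measure.toSignedMeasure_apply_measurable hA, smul_eq_mul] at h1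
  rw [Measure.smul_apply, ENNReal.smul_def, smul_eq_mul, ← ofReal_measureReal,
    ← ofReal_measureReal, ← ENNReal.ofReal_coe_nnreal, ← ENNReal.ofReal_mul (NNReal.coe_nonneg _)]
  refine ENNReal.ofReal_le_ofReal ?_
  push_cast
  linarith

theorem tiltedMeasure_of_not {γ : C(I, X)} (h : ¬Rectifiable γ) (f : X → ℝ) (K : ℝ≥0) :
    tiltedMeasure f K γ = 0 := dif_neg fun h' => h h'.1

theorem tiltedMeasure_zero_one (γ : C(I, X)) :
    tiltedMeasure (0 : X → ℝ) 1 γ = lengthMeasure γ := by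
  by_cases h : Rectifiable γ
  · exact h.tiltedMeasure_zero_one
  · rw [tiltedMeasure_of_not h, lengthMeasure, dif_neg h]

/-- Fubini for the mixture of the pushforwards, read back on the parameter interval. -/
theorem integrable_integral_bind [MeasurableSpace X] [BorelSpace X] [MeasurableSpace C(I, X)]
    {π : Measure C(I, X)} {κ : C(I, X) → Measure I}
    (hκ : Measurable fun γ => (κ γ).map γ) {h : X → ℝ}
    (hh : Integrable h (π.bind fun γ => (κ γ).map γ)) :
    (∀ᵐ γ ∂π, Integrable (fun t => h (γ t)) (κ γ)) ∧
      Integrable (fun γ => ∫ t, h (γ t) ∂κ γ) π ∧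
      ∫ γ, ∫ t, h (γ t) ∂κ γ ∂π = ∫ x, h x ∂π.bind fun γ => (κ γ).map γ := by
  let η : Kernel C(I, X) X := ⟨_, hκ⟩
  have hη : Integrable h ((η ∘ₖ (Kernel.const Unit π)) ()) := by
    rw [← Measure.comp_eq_comp_const_apply]; exact hh
  have h1 : ∀ᵐ γ ∂π, Integrable h ((κ γ).map γ) := hη.ae_of_comp
  have h2 : (fun γ => ∫ x, h x ∂(κ γ).map γ) =ᵐ[π] fun γ => ∫ t, h (γ t) ∂κ γ := by
    filter_upwards [h1] with γ hγ
    exact integral_map γ.continuous.measurable.aemeasurable hγ.1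
  have h3 : Integrable (fun γ => ∫ x, h x ∂(κ γ).map γ) π := hη.integral_comp
  refine ⟨?_, h3.congr h2, ?_⟩
  · filter_upwards [h1] with γ hγ
    exact (integrable_map_measure hγ.1 γ.continuous.measurable.aemeasurable).1 hγ
  · rw [← integral_congr_ae h2]
    have := Kernel.integral_comp hη
    rw [← Measure.comp_eq_comp_const_apply] at this
    exact this.symm

variable [MeasurableSpace C(I, X)] [BorelSpace C(I, X)]

/-- Variation is lower semicontinuous under pointwise convergence. -/
theorem measurable_eVariationOn (S : Set I) : Measurable fun γ : C(I, X) => eVariationOn γ S := by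
  refine LowerSemicontinuous.measurable fun γ v hv => ?_
  exact eVariationOn.lowerSemicontinuous_aux
    (fun t _ => (continuous_eval_const t).tendsto γ) hv

theorem measurableSet_rectifiable : MeasurableSet {γ : C(I, X) | Rectifiable γ} :=
  measurableSet_lt (measurable_eVariationOn univ) measurable_const

theorem measurable_arcLength (t : I) : Measurable fun γ : C(I, X) => arcLength γ t :=
  (measurable_eVariationOn _).ennreal_toReal

theorem measurable_tiltedMeasure {f : X → ℝ} {K : ℝ≥0} (hf : LipschitzWith K f) :
    Measurable fun γ : C(I, X) => tiltedMeasure f K γ := by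
  classical
  have key : ∀ t : I, Measurable fun γ : C(I, X) => tiltedMeasure f K γ (Icc 0 t) := by
    intro t
    have he : (fun γ : C(I, X) => tiltedMeasure f K γ (Icc 0 t)) = fun γ : C(I, X) =>
        if Rectifiable γ then
          ENNReal.ofReal (K * arcLength γ t + (f (γ t) - f (γ 0))) else 0 := by
      funext γ
      split_ifs with h
      · exact h.tiltedMeasure_Icc hf t
      · rw [tiltedMeasure_of_not h]; simp
    have hm : ∀ s : I, Measurable fun γ : C(I, X) => f (γ s) := fun s =>
      (hf.continuous.comp (continuous_eval_const s)).measurable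
    rw [he]
    exact Measurable.ite measurableSet_rectifiable (((measurable_arcLength t).const_mul _).add
      ((hm t).sub (hm 0))).ennreal_ofReal measurable_const
  refine Measurable.measure_of_isPiSystem
    ((BorelSpace.measurable_eq (α := I)).trans (borel_eq_generateFrom_Iic I)) isPiSystem_Iic ?_ ?_
  · rintro _ ⟨t, rfl⟩
    have hI : Iic t = Icc 0 t := by ext s; simp
    rw [hI]
    exact key t
  · rw [univ_eq_Icc_zero_one]
    exact key 1

variable [MeasurableSpace X] [BorelSpace X]

/-- Evaluation `(γ, t) ↦ γ t` is jointly measurable, and `γ⁻¹ A` is the `γ`-section of the preimage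
of `A` under it. -/
theorem measurable_map_curve {κ : C(I, X) → Measure I} (hκ : Measurable κ)
    (hfin : ∀ γ, IsFiniteMeasure (κ γ)) : Measurable fun γ : C(I, X) => (κ γ).map γ := by
  refine Measure.measurable_of_measurable_coe _ fun A hA => ?_
  have hev : Measurable fun p : C(I, X) × I => p.1 p.2 := by
    have : Continuous fun p : C(I, X) × I => p.1 p.2 := by fun_prop
    exact this.measurable
  have := Kernel.measurable_kernel_prodMk_left_of_finite (κ := ⟨κ, hκ⟩) (hev hA) hfin
  have he : ∀ γ : C(I, X), (κ γ).map γ A = κ γ (γ ⁻¹' A) := fun γ =>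
    Measure.map_apply γ.continuous.measurable hA
  simp_rw [he]
  exact this

theorem measurable_map_tiltedMeasure {f : X → ℝ} {K : ℝ≥0} (hf : LipschitzWith K f) :
    Measurable fun γ : C(I, X) => (tiltedMeasure f K γ).map γ :=
  measurable_map_curve (measurable_tiltedMeasure hf) fun _ => inferInstance

theorem measurable_map_lengthMeasure :
    Measurable fun γ : C(I, X) => (lengthMeasure γ).map γ := by
  simp_rw [← tiltedMeasure_zero_one]
  exact measurable_map_tiltedMeasure (LipschitzWith.const' 0)

/-- The measure `∫ γ_# (K s_γ + μ_{f ∘ γ}) dπ(γ)` on `X`. -/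
def tiltedCurveMeasure (f : X → ℝ) (K : ℝ≥0) (π : Measure C(I, X)) : Measure X :=
  π.bind fun γ => (tiltedMeasure f K γ).map γ

theorem tiltedCurveMeasure_le {f : X → ℝ} {K : ℝ≥0} (hf : LipschitzWith K f)
    (π : Measure C(I, X)) : tiltedCurveMeasure f K π ≤ (2 * K) • curveMeasure π := by
  refine Measure.le_intro fun A hA _ => ?_
  rw [tiltedCurveMeasure, curveMeasure, Measure.smul_apply,
    Measure.bind_apply hA (measurable_map_tiltedMeasure hf).aemeasurable,
    Measure.bind_apply hA measurable_map_lengthMeasure.aemeasurable, ENNReal.smul_def, smul_eq_mul,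
    ← lintegral_const_mul' _ _ ENNReal.coe_ne_top]
  refine lintegral_mono fun γ => ?_
  rw [Measure.map_apply γ.continuous.measurable hA, Measure.map_apply γ.continuous.measurable hA]
  by_cases h : Rectifiable γ
  · exact h.tiltedMeasure_le hf _
  · rw [tiltedMeasure_of_not h]; simp

/-- The integral of `g` along `μ_{f ∘ γ}` and then along `π`, for a Lipschitz function `f` vanishing
outside of the closed set `T`. -/
theorem integral_signedVariation_curve {π : Measure C(I, X)} (hπ : ∀ᵐ γ ∂π, Rectifiable γ)
    {f g : X → ℝ} {K : ℝ≥0} (hf : LipschitzWith K f) {T : Set X} (hT : IsClosed T)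
    (hfT : ∀ x ∉ T, f x = 0) (hg : IntegrableOn g T (curveMeasure π)) :
    (∀ᵐ γ ∂π, (signedVariation fun t => f (γ t)).Integrable fun t => g (γ t)) ∧
      Integrable (fun γ : C(I, X) => ∫ᵛ t, g (γ t) ∂•(signedVariation fun t => f (γ t))) π ∧
      ∫ γ, (∫ᵛ t, g (γ t) ∂•(signedVariation fun t => f (γ t))) ∂π =
        ∫ x in T, g x ∂tiltedCurveMeasure f K π - K * ∫ x in T, g x ∂curveMeasure π := by
  -- `g` is only integrable on `T`. Cutting it off there is free for `μ_{f∘γ}`, which does not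
  -- charge the open set `γ⁻¹ Tᶜ`, but it is needed for each of the two positive measures
  -- separately.
  have hi : Integrable (T.indicator g) (curveMeasure π) := hg.integrable_indicator hT.measurableSet
  have hi' : Integrable (T.indicator g) (tiltedCurveMeasure f K π) :=
    (hi.smul_measure_nnreal (c := 2 * K)).mono_measure (tiltedCurveMeasure_le hf π)
  obtain ⟨a1, a2, a3⟩ := integrable_integral_bind measurable_map_lengthMeasure hi
  obtain ⟨b1, b2, b3⟩ := integrable_integral_bind (measurable_map_tiltedMeasure hf) hi'
  have hae : ∀ γ : C(I, X), Rectifiable γ →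
      (fun t => g (γ t)) =ᵐ[(signedVariation fun t => f (γ t)).variation]
        fun t => T.indicator g (γ t) := by
    intro γ h
    have hz := variation_signedVariation_eq_zero (continuous_comp_curve hf γ)
      (h.boundedVariationOn_comp hf) (hT.isOpen_compl.preimage γ.continuous) fun t ht => hfT _ ht
    refine measure_mono_null (fun t ht => ?_) hz
    by_contra hc
    exact ht (by simp only [mem_preimage, mem_compl_iff, not_not] at hc; simp [hc])
  have hint : ∀ᵐ γ ∂π, (signedVariation fun t => f (γ t)).Integrable
      fun t => T.indicator g (γ t) := by
    filter_upwards [hπ, a1] with γ h h1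
    exact (h1.smul_measure_nnreal (c := K)).mono_measure (h.variation_signedVariation_comp_le hf)
  have heq : (fun γ : C(I, X) => ∫ᵛ t, g (γ t) ∂•(signedVariation fun t => f (γ t))) =ᵐ[π]
      fun γ => ∫ t, T.indicator g (γ t) ∂tiltedMeasure f K γ -
        K * ∫ t, T.indicator g (γ t) ∂lengthMeasure γ := by
    filter_upwards [hπ, a1, b1] with γ h h1 h2
    have h1' : (lengthMeasure γ).toSignedMeasure.Integrable fun t => T.indicator g (γ t) := by
      rw [VectorMeasure.Integrable, Measure.variation_toSignedMeasure]; exact h1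
    have h2' : (tiltedMeasure f K γ).toSignedMeasure.Integrable fun t => T.indicator g (γ t) := by
      rw [VectorMeasure.Integrable, Measure.variation_toSignedMeasure]; exact h2
    rw [VectorMeasure.integral_congr_ae (hae γ h), h.signedVariation_comp_eq hf,
      VectorMeasure.integral_sub_vectorMeasure h2' (h1'.smul_vectorMeasure _),
      VectorMeasure.integral_smul_vectorMeasure, integral_lsmul_toSignedMeasure,
      integral_lsmul_toSignedMeasure, smul_eq_mul]
  refine ⟨?_, (b2.sub (a2.const_mul _)).congr heq.symm, ?_⟩
  · filter_upwards [hπ, hint] with γ h h1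
    exact h1.congr (hae γ h).symm
  · rw [integral_congr_ae heq, integral_sub b2 (a2.const_mul _), integral_const_mul, a3, b3,
      integral_indicator hT.measurableSet, integral_indicator hT.measurableSet]
    rfl

/-- `|∫ μ_{f ∘ γ} (γ⁻¹ A) dπ(γ)| ≤ L Π_π(A)` if `f` is `L`-Lipschitz on an open set containing
`A`. -/
theorem abs_integral_signedVariation_le {π : Measure C(I, X)} (hπ : ∀ᵐ γ ∂π, Rectifiable γ)
    {f : X → ℝ} {K L : ℝ≥0} (hf : LipschitzWith K f) {U A : Set X} (hU : IsOpen U)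
    (hfU : LipschitzOnWith L f U) (hA : MeasurableSet A) (hAU : A ⊆ U)
    (hfin : curveMeasure π A ≠ ∞) :
    |∫ γ, (∫ᵛ t, A.indicator 1 (γ t) ∂•(signedVariation fun t => f (γ t))) ∂π| ≤
      L * (curveMeasure π).real A := by
  have hi : Integrable (A.indicator (1 : X → ℝ)) (curveMeasure π) :=
    (integrableOn_const hfin).integrable_indicator hA
  obtain ⟨a1, a2, a3⟩ := integrable_integral_bind measurable_map_lengthMeasure hi
  change _ = ∫ x, _ ∂curveMeasure π at a3
  rw [integral_indicator_one hA] at a3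
  rw [← a3, ← integral_const_mul]
  refine (abs_integral_le_integral_abs).trans (integral_mono_of_nonneg
    (Eventually.of_forall fun _ => abs_nonneg _) (a2.const_mul _) ?_)
  filter_upwards [hπ] with γ h
  have hAm : MeasurableSet (γ ⁻¹' A) := γ.continuous.measurable hA
  have he : ∀ t, A.indicator (1 : X → ℝ) (γ t) = (γ ⁻¹' A).indicator 1 t := fun t => rfl
  simp_rw [he]
  have hfv : IsFiniteMeasure (signedVariation fun t => f (γ t)).variation :=
    isFiniteMeasure_of_le _ (h.variation_signedVariation_comp_le hf)
  have h1 : ∫ᵛ t, (γ ⁻¹' A).indicator 1 t ∂•(signedVariation fun t => f (γ t)) =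
      (signedVariation fun t => f (γ t)) (γ ⁻¹' A) := by
    rw [VectorMeasure.integral_indicator hAm]
    have : IsFiniteMeasure ((signedVariation fun t => f (γ t)).restrict (γ ⁻¹' A)).variation := by
      rw [VectorMeasure.variation_restrict hAm]; infer_instance
    simp [VectorMeasure.restrict_apply _ hAm MeasurableSet.univ]
  rw [h1, integral_indicator_one hAm]
  have h2 := h.variation_signedVariation_restrict_le hf hU hfU (γ ⁻¹' A)
  rw [Measure.restrict_apply hAm, inter_eq_left.2 (preimage_mono hAU)] at h2
  have h3 := (VectorMeasure.enorm_measure_le_variation _ _).trans h2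
  rw [Measure.smul_apply, Real.enorm_eq_ofReal_abs, ENNReal.smul_def, smul_eq_mul,
    ← ofReal_measureReal, ← ENNReal.ofReal_coe_nnreal,
    ← ENNReal.ofReal_mul L.coe_nonneg] at h3
  exact (ENNReal.ofReal_le_ofReal_iff (by positivity)).1 h3

end Plans

/-! ### The asymptotic slope. -/

section Slope

variable {X : Type*} [MetricSpace X] {f : X → ℝ} {K : ℝ≥0}

theorem lipConst_nonneg (f : X → ℝ) (E : Set X) : 0 ≤ lipConst f E := by
  refine Real.sSup_nonneg ?_
  rintro c ⟨y, _, z, _, _, rfl⟩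
  positivity

theorem lipConst_le_of_lipschitzOnWith {E : Set X} (hf : LipschitzOnWith K f E) :
    lipConst f E ≤ K := by
  refine Real.sSup_le ?_ K.2
  rintro c ⟨y, hy, z, hz, hyz, rfl⟩
  rw [div_le_iff₀ (dist_pos.2 hyz), ← Real.dist_eq]
  exact hf.dist_le_mul y hy z hz

/-- The global Lipschitz bound keeps the difference quotients bounded; otherwise `sSup` would take
its default value `0`. -/
theorem lipschitzOnWith_lipConst (hf : LipschitzWith K f) (E : Set X) :
    LipschitzOnWith (lipConst f E).toNNReal f E := by
  refine LipschitzOnWith.of_dist_le_mul fun y hy z hz => ?_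
  rw [Real.coe_toNNReal _ (lipConst_nonneg f E)]
  rcases eq_or_ne y z with rfl | hyz
  · simp
  rw [← div_le_iff₀ (dist_pos.2 hyz), Real.dist_eq]
  refine le_csSup ⟨K, ?_⟩ ⟨y, hy, z, hz, hyz, rfl⟩
  rintro c ⟨y, hy, z, hz, hyz, rfl⟩
  rw [div_le_iff₀ (dist_pos.2 hyz), ← Real.dist_eq]
  exact hf.dist_le_mul y z

theorem lipConst_mono (hf : LipschitzWith K f) {E F : Set X} (h : E ⊆ F) :
    lipConst f E ≤ lipConst f F := by
  have := lipConst_le_of_lipschitzOnWith ((lipschitzOnWith_lipConst hf F).mono h)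
  rwa [Real.coe_toNNReal _ (lipConst_nonneg f F)] at this

theorem asympSlope_nonneg (f : X → ℝ) (x : X) : 0 ≤ asympSlope f x :=
  Real.iInf_nonneg fun _ => lipConst_nonneg _ _

theorem asympSlope_le_lipConst (f : X → ℝ) (x : X) {r : ℝ} (hr : 0 < r) :
    asympSlope f x ≤ lipConst f (Metric.ball x r) :=
  ciInf_le (f := fun r : Ioi (0 : ℝ) => lipConst f (Metric.ball x r))
    ⟨0, by rintro _ ⟨r, rfl⟩; exact lipConst_nonneg _ _⟩ ⟨r, hr⟩

theorem asympSlope_le (hf : LipschitzWith K f) (x : X) : asympSlope f x ≤ K :=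
  (asympSlope_le_lipConst f x one_pos).trans (lipConst_le_of_lipschitzOnWith hf.lipschitzOnWith)

theorem exists_lipConst_lt {x : X} {c : ℝ} (h : asympSlope f x < c) :
    ∃ r > 0, lipConst f (Metric.ball x r) < c := by
  have : Nonempty (Ioi (0 : ℝ)) := ⟨⟨1, mem_Ioi.2 one_pos⟩⟩
  obtain ⟨r, hr⟩ := exists_lt_of_ciInf_lt h
  exact ⟨r, r.2, hr⟩

theorem asympSlope_eq_zero_of_notMem_tsupport {x : X} (hx : x ∉ tsupport f) :
    asympSlope f x = 0 := by
  obtain ⟨r, hr, hsub⟩ := Metric.isOpen_iff.1 (isClosed_tsupport f).isOpen_compl x hx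
  refine le_antisymm ?_ (asympSlope_nonneg f x)
  refine (asympSlope_le_lipConst f x hr).trans ?_
  have : LipschitzOnWith 0 f (Metric.ball x r) := by
    refine LipschitzOnWith.of_dist_le_mul fun y hy z hz => ?_
    rw [image_eq_zero_of_notMem_tsupport (hsub hy), image_eq_zero_of_notMem_tsupport (hsub hz)]
    simp
  exact lipConst_le_of_lipschitzOnWith this

/-- The asymptotic slope at `x` of `f g - c g - d f = (f - c) (g - d) - c d`. -/
theorem asympSlope_mul_sub_le {g : X → ℝ} {L : ℝ≥0} (hf : LipschitzWith K f)
    (hg : LipschitzWith L g) (c d : ℝ) (x : X) :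
    asympSlope (fun y => f y * g y - c * g y - d * f y) x ≤ |f x - c| * L + |g x - d| * K := by
  have key : ∀ r > 0, asympSlope (fun y => f y * g y - c * g y - d * f y) x ≤
      |f x - c| * L + |g x - d| * K + 2 * K * L * r := by
    intro r hr
    have hC : 0 ≤ (|f x - c| + K * r) * L + (|g x - d| + L * r) * K := by positivity
    have hl : LipschitzOnWith ((|f x - c| + K * r) * L + (|g x - d| + L * r) * K).toNNReal
        (fun y => f y * g y - c * g y - d * f y) (Metric.ball x r) := by
      refine LipschitzOnWith.of_dist_le_mul fun y hy z hz => ?_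
      rw [Real.coe_toNNReal _ hC, Real.dist_eq]
      have h1 := hf.dist_le_mul y z
      have h2 := hg.dist_le_mul y z
      have h3 := hf.dist_le_mul y x
      have h4 := hg.dist_le_mul z x
      rw [Real.dist_eq] at h1 h2 h3 h4
      have hy' : dist y x ≤ r := (Metric.mem_ball.1 hy).le
      have hz' : dist z x ≤ r := (Metric.mem_ball.1 hz).le
      have h5 : |f y - c| ≤ |f x - c| + K * r := by
        have e : f y - c = (f x - c) + (f y - f x) := by ring
        rw [e]
        exact (abs_add_le _ _).trans (add_le_add le_rfl (h3.trans
          (mul_le_mul_of_nonneg_left hy' K.coe_nonneg)))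
      have h6 : |g z - d| ≤ |g x - d| + L * r := by
        have e : g z - d = (g x - d) + (g z - g x) := by ring
        rw [e]
        exact (abs_add_le _ _).trans (add_le_add le_rfl (h4.trans
          (mul_le_mul_of_nonneg_left hz' L.coe_nonneg)))
      have e : f y * g y - c * g y - d * f y - (f z * g z - c * g z - d * f z) =
          (f y - c) * (g y - g z) + (g z - d) * (f y - f z) := by ring
      rw [e]
      calc _ ≤ |f y - c| * |g y - g z| + |g z - d| * |f y - f z| := by
            rw [← abs_mul, ← abs_mul]; exact abs_add_le _ _
        _ ≤ (|f x - c| + K * r) * (L * dist y z) + (|g x - d| + L * r) * (K * dist y z) := by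
            gcongr
        _ = _ := by ring
    have := (asympSlope_le_lipConst _ x hr).trans (lipConst_le_of_lipschitzOnWith hl)
    rw [Real.coe_toNNReal _ hC] at this
    linarith
  refine le_of_forall_pos_le_add fun ε hε => ?_
  -- The radius makes the error `2 K L r` at most `ε`; the `+ 1` covers `K L = 0`.
  have hpos : (0 : ℝ) < 2 * K * L + 1 := by positivity
  refine (key (ε / (2 * K * L + 1)) (by positivity)).trans ?_
  have : 2 * (K : ℝ) * L * (ε / (2 * K * L + 1)) ≤ ε := by
    rw [mul_div_assoc', div_le_iff₀ hpos]
    nlinarith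
  linarith

/-- A bound by Lipschitz constants on the balls of a countable base is a bound by the asymptotic
slope. -/
theorem le_mul_asympSlope_of_forall_ball {S : Set X} (hS : Dense S) (hf : LipschitzWith K f) {x : X}
    {a B : ℝ} (hB : 0 ≤ B) (h : ∀ y ∈ S, ∀ n : ℕ, x ∈ Metric.ball y (1 / ((n : ℝ) + 1)) →
      a ≤ B * lipConst f (Metric.ball y (1 / ((n : ℝ) + 1)))) : a ≤ B * asympSlope f x := by
  have key : ∀ c > asympSlope f x, a ≤ B * c := by
    intro c hc
    obtain ⟨r, hr, hrc⟩ := exists_lipConst_lt hc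
    -- Half of `r`, so that the ball about a nearby point `y` of `S` contains `x` and lies in
    -- `B_r(x)`.
    obtain ⟨n, hn⟩ := exists_nat_one_div_lt (half_pos hr)
    have hn0 : (0 : ℝ) < 1 / ((n : ℝ) + 1) := Nat.one_div_pos_of_nat
    obtain ⟨y, hy, hyS⟩ := hS.exists_dist_lt x hn0
    refine (h y hy n (Metric.mem_ball.2 hyS)).trans ?_
    refine mul_le_mul_of_nonneg_left ((lipConst_mono hf ?_).trans hrc.le) hB
    refine Metric.ball_subset_ball' ?_
    rw [dist_comm]
    linarith
  have ht : Tendsto (fun c => B * c) (𝓝[>] asympSlope f x) (𝓝 (B * asympSlope f x)) :=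
    (tendsto_id.const_mul B).mono_left nhdsWithin_le_nhds
  exact ge_of_tendsto ht (eventually_mem_nhdsWithin.mono key)

end Slope

/-! ### Uniqueness of the divergence. -/

section Divergence

variable {X : Type*} [MetricSpace X] [MeasurableSpace X]

namespace BoundedlyFiniteSignedMeasure

theorem trace_apply (ν : BoundedlyFiniteSignedMeasure X) {B : Set X} (hB : MeasurableSet B)
    (hb : Bornology.IsBounded B) {E : Set X} (hE : MeasurableSet E) :
    ν.trace B E = ν.toFun (B ∩ E) := by
  rw [trace, dif_pos ⟨hB, hb⟩]
  exact (ν.exists_trace B ⟨hB, hb⟩).choose_spec E hE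

theorem trace_restrict (ν : BoundedlyFiniteSignedMeasure X) {B C : Set X} (hB : MeasurableSet B)
    (hb : Bornology.IsBounded B) (hC : MeasurableSet C) (hCB : C ⊆ B) :
    (ν.trace B).restrict C = ν.trace C := by
  ext E hE
  rw [VectorMeasure.restrict_apply _ hC hE, trace_apply ν hB hb (hE.inter hC),
    trace_apply ν hC (hb.subset hCB) hE, inter_comm E C, ← inter_assoc, inter_eq_right.2 hCB]

variable [BorelSpace X]

theorem integral_eq_integral_trace (ν : BoundedlyFiniteSignedMeasure X) {f : X → ℝ} {B : Set X}
    (hB : MeasurableSet B) (hb : Bornology.IsBounded B) (hf : tsupport f ⊆ B) :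
    ν.integral f = ∫ᵛ x, f x ∂•(ν.trace B) := by
  have hT : MeasurableSet (tsupport f) := (isClosed_tsupport f).measurableSet
  have h : ∀ x, f x = (tsupport f).indicator f x := fun x => by
    rw [indicator_eq_self.2 (subset_tsupport f)]
  rw [integral, ← trace_restrict ν hB hb hT hf, ← VectorMeasure.integral_indicator hT]
  simp_rw [← h]

end BoundedlyFiniteSignedMeasure

instance isFiniteMeasure_variation {Ω : Type*} [MeasurableSpace Ω] (μ : SignedMeasure Ω) :
    IsFiniteMeasure μ.variation := by
  rw [← SignedMeasure.totalVariation_eq_variation]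
  unfold SignedMeasure.totalVariation
  infer_instance

variable [BorelSpace X]

/-- A boundedly-finite signed measure is determined by the integrals of Lipschitz functions with
bounded support. -/
theorem BoundedlyFiniteSignedMeasure.ext_of_integral {ν ν' : BoundedlyFiniteSignedMeasure X}
    (h : ∀ f : LIPbs X, ν.integral f = ν'.integral f) : ν = ν' := by
  rcases isEmpty_or_nonempty X with hX | ⟨⟨x₀⟩⟩
  · have hz : ∀ (ν : BoundedlyFiniteSignedMeasure X) B, ν.toFun B = 0 := by
      intro ν B
      have h1 := trace_apply ν MeasurableSet.empty Bornology.isBounded_empty MeasurableSet.empty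
      rw [VectorMeasure.empty, inter_self] at h1
      rw [Set.eq_empty_of_isEmpty B, h1]
    ext B
    rw [hz, hz]
  -- Thickened indicators of `F` are Lipschitz and decrease to its indicator. Their thickness is at
  -- most `1`, so the trace on the ball of radius `R + 1` sees all of them.
  have key : ∀ (R : ℝ) (F : Set X), IsClosed F → F ⊆ Metric.closedBall x₀ R →
      ν.trace (Metric.closedBall x₀ (R + 1)) F = ν'.trace (Metric.closedBall x₀ (R + 1)) F := by
    intro R F hF hFR
    have hδ : ∀ n : ℕ, (0 : ℝ) < 1 / ((n : ℝ) + 1) := fun n => Nat.one_div_pos_of_nat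
    let φ : ℕ → X → ℝ := fun n x => thickenedIndicator (hδ n) F x
    have hφc : ∀ n, Continuous (φ n) := fun n =>
      NNReal.continuous_coe.comp (thickenedIndicator (hδ n) F).continuous
    have hsupp : ∀ n, Function.support (φ n) ⊆ Metric.closedBall x₀ (R + 1) := by
      intro n x hx
      by_contra hc
      refine hx ?_
      have hx' : x ∉ Metric.thickening (1 / ((n : ℝ) + 1)) F := by
        intro hxt
        obtain ⟨y, hy, hxy⟩ := Metric.mem_thickening_iff.1 hxt
        refine hc (Metric.mem_closedBall.2 ?_)
        have h1 := Metric.mem_closedBall.1 (hFR hy)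
        have h2 : 1 / ((n : ℝ) + 1) ≤ 1 := by
          rw [div_le_one (by positivity)]
          linarith [n.cast_nonneg (α := ℝ)]
        linarith [dist_triangle x y x₀]
      exact congrArg NNReal.toReal (thickenedIndicator_zero (hδ n) F hx')
    have htsupp : ∀ n, tsupport (φ n) ⊆ Metric.closedBall x₀ (R + 1) := fun n =>
      closure_minimal (hsupp n) Metric.isClosed_closedBall
    have hmem : ∀ n, φ n ∈ LIPbs X := fun n =>
      ⟨⟨_, LipschitzWith.subtype_val (fun r : ℝ => 0 ≤ r) |>.comp
          (lipschitzWith_thickenedIndicator (hδ n) F)⟩,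
        Metric.isBounded_closedBall.subset (hsupp n)⟩
    have hlim : ∀ ρ : SignedMeasure X,
        Tendsto (fun n => ∫ᵛ x, φ n x ∂•ρ) atTop (𝓝 (ρ F)) := by
      intro ρ
      have hF1 : ∫ᵛ x, F.indicator 1 x ∂•ρ = ρ F := by
        rw [VectorMeasure.integral_indicator hF.measurableSet]
        simp [VectorMeasure.restrict_apply _ hF.measurableSet MeasurableSet.univ]
      rw [← hF1]
      refine VectorMeasure.tendsto_integral_of_dominated_convergence (fun _ => 1)
        (fun n => (hφc n).measurable.aestronglyMeasurable) (integrable_const _)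
        (fun n => Eventually.of_forall fun x => ?_) (Eventually.of_forall fun x => ?_)
      · rw [Real.norm_eq_abs, abs_of_nonneg (NNReal.coe_nonneg _)]
        exact_mod_cast thickenedIndicator_le_one (hδ n) F x
      · have h1 := thickenedIndicator_tendsto_indicator_closure hδ
          tendsto_one_div_add_atTop_nhds_zero_nat F
        rw [hF.closure_eq, tendsto_pi_nhds] at h1
        have h2 := (NNReal.continuous_coe.tendsto _).comp (h1 x)
        have e : F.indicator (1 : X → ℝ) x = (F.indicator (fun _ => (1 : ℝ≥0)) x : ℝ≥0) := by
          by_cases hx : x ∈ F <;> simp [hx]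
        rw [e]
        exact h2
    refine tendsto_nhds_unique (hlim _) ((hlim _).congr fun n => ?_)
    have h1 := h ⟨φ n, hmem n⟩
    rwa [integral_eq_integral_trace ν measurableSet_closedBall Metric.isBounded_closedBall
      (htsupp n), integral_eq_integral_trace ν' measurableSet_closedBall
      Metric.isBounded_closedBall (htsupp n), eq_comm] at h1
  have hext : ∀ R : ℝ, ν.trace (Metric.closedBall x₀ R) = ν'.trace (Metric.closedBall x₀ R) := by
    intro R
    have hsub : Metric.closedBall x₀ R ⊆ Metric.closedBall x₀ (R + 1) :=
      Metric.closedBall_subset_closedBall (by linarith)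
    have hcl : ∀ F : Set X, IsClosed F →
        ν.trace (Metric.closedBall x₀ R) F = ν'.trace (Metric.closedBall x₀ R) F := by
      intro F hF
      rw [← trace_restrict ν measurableSet_closedBall Metric.isBounded_closedBall
        measurableSet_closedBall hsub, ← trace_restrict ν' measurableSet_closedBall
        Metric.isBounded_closedBall measurableSet_closedBall hsub,
        VectorMeasure.restrict_apply _ measurableSet_closedBall hF.measurableSet,
        VectorMeasure.restrict_apply _ measurableSet_closedBall hF.measurableSet]
      exact key R _ (hF.inter Metric.isClosed_closedBall) inter_subset_right
    exact VectorMeasure.ext_of_generateFrom {F | IsClosed F} hcl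
      ((BorelSpace.measurable_eq (α := X)).trans borel_eq_generateFrom_isClosed)
      isPiSystem_isClosed (hcl _ isClosed_univ)
  ext B
  by_cases hB : MeasurableSet B ∧ Bornology.IsBounded B
  · obtain ⟨R, hR⟩ := hB.2.subset_closedBall x₀
    have h1 := trace_apply ν measurableSet_closedBall Metric.isBounded_closedBall
      (B := Metric.closedBall x₀ R) hB.1
    have h2 := trace_apply ν' measurableSet_closedBall Metric.isBounded_closedBall
      (B := Metric.closedBall x₀ R) hB.1
    rw [inter_eq_right.2 hR] at h1 h2
    rw [← h1, ← h2, hext]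
  · rw [ν.toFun_of_not B hB, ν'.toFun_of_not B hB]

end Divergence

/-! ### Existence of a least bound. -/

section PointwiseNorm

variable {X : Type*} [MetricSpace X] [MeasurableSpace X] {m : Measure X} {q : ℝ≥0∞}

/-- The pointwise norm of a derivation exists and is itself a bound. -/
theorem LipDerivation.exists_isLeast_bounds [SigmaFinite m] (b : LipDerivation m q) :
    ∃ N, IsLeast b.bounds N := by
  -- A strictly increasing functional, finite on all of `L^q`: `arctan` is bounded and `m.toFinite`
  -- is finite with the null sets of `m`. The infimum of a minimising sequence is the least bound.
  let φ : Lp ℝ q m → ℝ := fun G => ∫ x, Real.arctan (G x) ∂m.toFinite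
  have hae : ∀ {p : X → Prop}, (∀ᵐ x ∂m, p x) → ∀ᵐ x ∂m.toFinite, p x := fun h => by
    rw [ae_toFinite]; exact h
  have hint : ∀ G : Lp ℝ q m, Integrable (fun x => Real.arctan (G x)) m.toFinite := by
    intro G
    refine Integrable.of_bound (C := Real.pi / 2) ?_ (Eventually.of_forall fun x => ?_)
    · exact Real.continuous_arctan.comp_aestronglyMeasurable
        ((Lp.aestronglyMeasurable G).mono_ac (Measure.ae_le_iff_absolutelyContinuous.1 (by simp)))
    · rw [Real.norm_eq_abs, abs_le]
      exact ⟨(Real.neg_pi_div_two_lt_arctan _).le, (Real.arctan_lt_pi_div_two _).le⟩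
  have hpos : ∀ G ∈ b.bounds, ∀ᵐ x ∂m, 0 ≤ G x := fun G hG => (Lp.coeFn_nonneg G).2 hG.1
  have hφ0 : ∀ G ∈ b.bounds, 0 ≤ φ G := fun G hG => integral_nonneg_of_ae (by
    filter_upwards [hae (hpos G hG)] with x hx
    exact Real.arctan_nonneg.2 hx)
  have hbdd : BddBelow (φ '' b.bounds) := ⟨0, by rintro _ ⟨G, hG, rfl⟩; exact hφ0 G hG⟩
  have hne : (φ '' b.bounds).Nonempty := by
    obtain ⟨G, hG⟩ := b.weak_locality
    exact ⟨φ G, G, hG, rfl⟩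
  obtain ⟨u, -, hu, hmem⟩ := exists_seq_tendsto_sInf hne hbdd
  choose G hG hGu using hmem
  have hG0 : ∀ᵐ x ∂m, ∀ n, 0 ≤ G n x := ae_all_iff.2 fun n => hpos _ (hG n)
  have hNmem : MemLp (fun x => ⨅ n, G n x) q m := by
    refine (Lp.memLp (G 0)).mono' ?_ ?_
    · exact (AEMeasurable.iInf fun n => (Lp.aestronglyMeasurable (G n)).aemeasurable).aestronglyMeasurable
    · filter_upwards [hG0] with x hx
      rw [Real.norm_eq_abs, abs_of_nonneg (Real.iInf_nonneg hx)]
      exact ciInf_le ⟨0, by rintro _ ⟨n, rfl⟩; exact hx n⟩ 0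
  let N : Lp ℝ q m := hNmem.toLp _
  have hN : N =ᵐ[m] fun x => ⨅ n, G n x := hNmem.coeFn_toLp
  have hNle : ∀ n, ∀ᵐ x ∂m, N x ≤ G n x := by
    intro n
    filter_upwards [hN, hG0] with x hx h0
    rw [hx]
    exact ciInf_le ⟨0, by rintro _ ⟨n, rfl⟩; exact h0 n⟩ n
  have hNb : N ∈ b.bounds := by
    refine ⟨(Lp.coeFn_nonneg N).1 ?_, fun f => ?_⟩
    · filter_upwards [hN, hG0] with x hx h0
      rw [hx]
      exact Real.iInf_nonneg h0
    · filter_upwards [hN, hG0, ae_all_iff.2 fun n => (hG n).2 f] with x hx h0 hf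
      rw [hx, Real.iInf_mul_of_nonneg (asympSlope_nonneg _ _)]
      exact le_ciInf hf
  refine ⟨N, hNb, fun G' hG' => ?_⟩
  have hMmem : MemLp (fun x => min (N x) (G' x)) q m := (Lp.memLp N).inf (Lp.memLp G')
  let M : Lp ℝ q m := hMmem.toLp _
  have hM : M =ᵐ[m] fun x => min (N x) (G' x) := hMmem.coeFn_toLp
  have hMb : M ∈ b.bounds := by
    refine ⟨(Lp.coeFn_nonneg M).1 ?_, fun f => ?_⟩
    · filter_upwards [hM, hpos N hNb, hpos G' hG'] with x hx h1 h2
      rw [hx]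
      exact le_min h1 h2
    · filter_upwards [hM, hNb.2 f, hG'.2 f] with x hx h1 h2
      rw [hx, min_mul_of_nonneg _ _ (asympSlope_nonneg _ _)]
      exact le_min h1 h2
  -- The minimum `M` of `N` and `G'` is again a bound, so minimality gives `φ N ≤ φ M`. Together
  -- with `M ≤ N` this forces `M = N`, hence `N ≤ G'`.
  have hle1 : φ N ≤ φ M := by
    refine (ge_of_tendsto' hu fun n => ?_).trans (csInf_le hbdd ⟨M, hMb, rfl⟩)
    rw [← hGu]
    refine integral_mono_ae (hint N) (hint (G n)) ?_
    filter_upwards [hae (hNle n)] with x hx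
    exact Real.arctan_mono hx
  have hle2 : (fun x => Real.arctan (M x)) ≤ᵐ[m.toFinite] fun x => Real.arctan (N x) := by
    filter_upwards [hae hM] with x hx
    rw [hx]
    exact Real.arctan_mono (min_le_left _ _)
  have heq := (integral_eq_iff_of_ae_le (hint M) (hint N) hle2).1
    (le_antisymm (integral_mono_ae (hint M) (hint N) hle2) hle1)
  have heq' : ∀ᵐ x ∂m, Real.arctan (M x) = Real.arctan (N x) := by
    rw [← ae_toFinite]; exact heq
  refine (Lp.coeFn_le N G').1 ?_
  filter_upwards [heq', hM] with x h1 h2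
  rw [← Real.arctan_injective h1, h2]
  exact min_le_right _ _

end PointwiseNorm

/-! ### The barycenter and the density of the averaged signed variation. -/

section Density

theorem ae_lt_top_of_eLpNorm_lt_top {X : Type*} [MeasurableSpace X] {m : Measure X} {q : ℝ≥0∞}
    (hq : q ≠ 0) {F : X → ℝ≥0∞}
    (hF : Measurable F) (h : eLpNorm F q m < ∞) : ∀ᵐ x ∂m, F x < ∞ := by
  rcases eq_or_ne q ∞ with rfl | hq'
  · rw [eLpNorm_exponent_top] at h
    filter_upwards [ae_lt_of_essSup_lt h] with x hx
    simpa using hx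
  · rw [eLpNorm_lt_top_iff_lintegral_rpow_enorm_lt_top hq hq'] at h
    have hpos := ENNReal.toReal_pos hq hq'
    filter_upwards [ae_lt_top (by fun_prop) h.ne] with x hx
    by_contra hc
    rw [not_lt, top_le_iff] at hc
    simp [hc, hpos] at hx

/-- Lengths need not be `π`-integrable, so `Π_π` may be infinite. Slicing by the integer part of the
mass gives finite pieces; s-finiteness suffices to recover `Π_π` from `Bar(π)`. -/
theorem sFinite_bind {X Γ : Type*} [MeasurableSpace X] [MeasurableSpace Γ] {π : Measure Γ}
    [IsFiniteMeasure π] {κ : Γ → Measure X}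
    (hκ : Measurable κ) (hfin : ∀ γ, IsFiniteMeasure (κ γ)) : SFinite (π.bind κ) := by
  let S : ℕ → Set Γ := fun n => {γ | ⌊(κ γ univ).toNNReal⌋₊ = n}
  have hmeas : Measurable fun γ => ⌊(κ γ univ).toNNReal⌋₊ :=
    Nat.measurable_floor.comp ((Measure.measurable_coe MeasurableSet.univ).comp hκ).ennreal_toNNReal
  have hS : ∀ n, MeasurableSet (S n) := fun n => hmeas (measurableSet_singleton n)
  have hd : Pairwise (Function.onFun Disjoint S) := by
    intro i j hij
    refine disjoint_left.2 fun γ hi hj => hij ?_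
    exact hi.symm.trans hj
  have hU : ⋃ n, S n = univ := eq_univ_of_forall fun γ => mem_iUnion.2 ⟨_, rfl⟩
  have hπ : π = Measure.sum fun n => π.restrict (S n) := by
    rw [← Measure.restrict_iUnion hd hS, hU, Measure.restrict_univ]
  have hf : ∀ n, IsFiniteMeasure ((π.restrict (S n)).bind κ) := by
    intro n
    refine ⟨?_⟩
    rw [Measure.bind_apply MeasurableSet.univ hκ.aemeasurable]
    refine (setLIntegral_mono (g := fun _ => ((n : ℝ≥0∞) + 1)) measurable_const
      fun γ hγ => ?_).trans_lt ?_
    · have h1 := (Nat.lt_floor_add_one (κ γ univ).toNNReal).le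
      rw [show ⌊(κ γ univ).toNNReal⌋₊ = n from hγ] at h1
      rw [← ENNReal.coe_toNNReal (measure_ne_top (κ γ) univ)]
      exact_mod_cast h1
    · rw [setLIntegral_const]
      exact ENNReal.mul_lt_top (by simp) (measure_lt_top _ _)
  rw [hπ, Measure.bind_sum _ _ hκ.aemeasurable]
  infer_instance

section Barycenter

variable {X : Type*} [MetricSpace X] [MeasurableSpace X] [MeasurableSpace C(I, X)]
  {π : Measure C(I, X)} {m : Measure X} {q : ℝ≥0∞}

theorem HasBarycenter.memLp_toReal (h : HasBarycenter π m q) :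
    MemLp (fun x => (bar π m x).toReal) q m := by
  refine ⟨(Measure.measurable_rnDeriv _ _).ennreal_toReal.aestronglyMeasurable,
    (eLpNorm_mono_enorm fun x => ?_).trans_lt h.memLp⟩
  rw [enorm_eq_self, Real.enorm_eq_ofReal ENNReal.toReal_nonneg]
  exact ENNReal.ofReal_toReal_le

theorem HasBarycenter.ae_lt_top (h : HasBarycenter π m q) (hq : 1 < q) :
    ∀ᵐ x ∂m, bar π m x < ∞ :=
  ae_lt_top_of_eLpNorm_lt_top (zero_lt_one.trans hq).ne' (Measure.measurable_rnDeriv _ _) h.memLp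

theorem HasBarycenter.integrableOn_toReal (h : HasBarycenter π m q) (hq : 1 < q) {B : Set X}
    (hB : m B < ∞) : IntegrableOn (fun x => (bar π m x).toReal) B m := by
  have : IsFiniteMeasure (m.restrict B) := ⟨by rwa [Measure.restrict_apply_univ]⟩
  exact (h.memLp_toReal.restrict B).integrable hq.le

end Barycenter

variable {X : Type*} [MetricSpace X] [MeasurableSpace X] [BorelSpace X]

theorem sigmaFinite_of_measure_lt_top_of_isBounded {m : Measure X}
    (hm : ∀ B : Set X, MeasurableSet B → Bornology.IsBounded B → m B < ∞) : SigmaFinite m := by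
  rcases isEmpty_or_nonempty X with hX | ⟨⟨x₀⟩⟩
  · rw [Measure.eq_zero_of_isEmpty m]; infer_instance
  exact ⟨⟨⟨fun n => Metric.ball x₀ n, fun _ => trivial,
    fun n => hm _ measurableSet_ball Metric.isBounded_ball, Metric.iUnion_ball_nat x₀⟩⟩⟩

variable [MeasurableSpace C(I, X)] [BorelSpace C(I, X)]

instance sFinite_curveMeasure (π : Measure C(I, X)) [IsFiniteMeasure π] :
    SFinite (curveMeasure π) :=
  sFinite_bind measurable_map_lengthMeasure fun _ => inferInstance

variable {π : Measure C(I, X)} [IsFiniteMeasure π] {m : Measure X} {q : ℝ≥0∞}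

theorem HasBarycenter.curveMeasure_apply [SigmaFinite m] (h : HasBarycenter π m q) {A : Set X}
    (hA : MeasurableSet A) : curveMeasure π A = ∫⁻ x in A, bar π m x ∂m := by
  conv_lhs => rw [← Measure.withDensity_rnDeriv_eq _ _ h.absolutelyContinuous]
  exact withDensity_apply _ hA

theorem HasBarycenter.curveMeasure_lt_top [SigmaFinite m] (h : HasBarycenter π m q) (hq : 1 < q)
    {B : Set X} (hB : MeasurableSet B) (hmB : m B < ∞) : curveMeasure π B < ∞ := by
  have h1 := (h.integrableOn_toReal hq hmB).lintegral_lt_top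
  rw [h.curveMeasure_apply hB]
  refine lt_of_le_of_lt (lintegral_mono_ae ?_) h1
  filter_upwards [ae_restrict_of_ae (h.ae_lt_top hq)] with x hx
  rw [ENNReal.ofReal_toReal hx.ne]

theorem HasBarycenter.curveMeasure_real [SigmaFinite m] (h : HasBarycenter π m q) (hq : 1 < q)
    {A : Set X} (hA : MeasurableSet A) :
    (curveMeasure π).real A = ∫ x in A, (bar π m x).toReal ∂m := by
  have hmeas : Measurable (bar π m) := Measure.measurable_rnDeriv _ _
  rw [measureReal_def, h.curveMeasure_apply hA]
  exact (integral_toReal (f := bar π m) hmeas.aemeasurable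
    (ae_restrict_of_ae (h.ae_lt_top hq))).symm

/-- The density with respect to `m` of the signed measure `A ↦ ∫ μ_{f ∘ γ} (γ⁻¹ A) dπ(γ)`. -/
theorem exists_density [TopologicalSpace.SeparableSpace X]
    (hm : ∀ B : Set X, MeasurableSet B → Bornology.IsBounded B → m B < ∞) (hq : 1 < q)
    (hπ : IsPlan π) (hbar : HasBarycenter π m q) (f : LIPbs X) :
    (∀ g : X → ℝ, MemLp g ∞ m →
      (∀ᵐ γ ∂π, (signedVariation fun t => (f : X → ℝ) (γ t)).Integrable fun t => g (γ t)) ∧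
      Integrable (fun γ : C(I, X) => ∫ᵛ t, g (γ t)
        ∂•(signedVariation fun t => (f : X → ℝ) (γ t))) π) ∧
    ∃ h : X → ℝ, Integrable h m ∧
      (∀ g : X → ℝ, MemLp g ∞ m → ∫ x, g x * h x ∂m =
        ∫ γ, (∫ᵛ t, g (γ t) ∂•(signedVariation fun t => (f : X → ℝ) (γ t))) ∂π) ∧
      ∀ᵐ x ∂m, |h x| ≤ (bar π m x).toReal * asympSlope f x := by
  have hσ : SigmaFinite m := sigmaFinite_of_measure_lt_top_of_isBounded hm
  obtain ⟨f, ⟨K, hf⟩, hfb⟩ := f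
  dsimp only
  have hT : IsClosed (tsupport f) := isClosed_tsupport f
  have hTb : Bornology.IsBounded (tsupport f) := hfb.closure
  have hfT : ∀ x ∉ tsupport f, f x = 0 := fun x hx => image_eq_zero_of_notMem_tsupport hx
  have hac1 : (curveMeasure π).restrict (tsupport f) ≪ m :=
    Measure.restrict_le_self.absolutelyContinuous.trans hbar.absolutelyContinuous
  have hac2 : (tiltedCurveMeasure f K π).restrict (tsupport f) ≪ m :=
    (Measure.absolutelyContinuous_of_le_smul (Measure.restrict_le_self.trans
      (tiltedCurveMeasure_le hf π))).trans hbar.absolutelyContinuous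
  -- `L^q` embeds in `L¹` on the bounded set `tsupport f`, which has finite `m`-measure.
  have hfin1 : IsFiniteMeasure ((curveMeasure π).restrict (tsupport f)) := ⟨by
    rw [Measure.restrict_apply_univ]
    exact hbar.curveMeasure_lt_top hq hT.measurableSet (hm _ hT.measurableSet hTb)⟩
  have hfin2 : IsFiniteMeasure ((tiltedCurveMeasure f K π).restrict (tsupport f)) := by
    refine isFiniteMeasure_of_le ((2 * K) • (curveMeasure π).restrict (tsupport f)) ?_
    rw [← Measure.restrict_smul]
    exact Measure.restrict_mono Subset.rfl (tiltedCurveMeasure_le hf π)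
  have hint : ∀ {ν : Measure X} [IsFiniteMeasure ν], ν ≪ m → ∀ g : X → ℝ, MemLp g ∞ m →
      Integrable g ν := fun hν g hg => by
    obtain ⟨C, hC⟩ := eLpNormEssSup_lt_top_iff_isBoundedUnder.1
      (by simpa [eLpNorm_exponent_top] using hg.2)
    refine Integrable.of_bound (hg.1.mono_ac hν) C ?_
    filter_upwards [hν.ae_le (eventually_map.1 hC)] with x hx
    exact_mod_cast hx
  have hmain := fun (g : X → ℝ) (hg : MemLp g ∞ m) =>
    integral_signedVariation_curve hπ hf hT hfT (hint hac1 g hg)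
  refine ⟨fun g hg => ⟨(hmain g hg).1, (hmain g hg).2.1⟩, ?_⟩
  let h : X → ℝ := fun x =>
    (((tiltedCurveMeasure f K π).restrict (tsupport f)).rnDeriv m x).toReal -
      K * (((curveMeasure π).restrict (tsupport f)).rnDeriv m x).toReal
  have hh : Integrable h m := Measure.integrable_toReal_rnDeriv.sub
    (Measure.integrable_toReal_rnDeriv.const_mul _)
  have hrep : ∀ g : X → ℝ, MemLp g ∞ m → ∫ x, g x * h x ∂m =
      ∫ γ, (∫ᵛ t, g (γ t) ∂•(signedVariation fun t => f (γ t))) ∂π := by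
    intro g hg
    have i1 := (integrable_toReal_rnDeriv_mul_iff hac1).2 (hint hac1 g hg)
    have i2 := (integrable_toReal_rnDeriv_mul_iff hac2).2 (hint hac2 g hg)
    rw [(hmain g hg).2.2, ← integral_toReal_rnDeriv_mul hac1, ← integral_toReal_rnDeriv_mul hac2,
      ← integral_const_mul, ← integral_sub i2 (i1.const_mul _)]
    congr 1
    funext x
    simp only [h]
    ring
  refine ⟨h, hh, hrep, ?_⟩
  have hball : ∀ (y : X) (r : ℝ), ∀ᵐ x ∂m, x ∈ Metric.ball y r →
      |h x| ≤ (bar π m x).toReal * lipConst f (Metric.ball y r) := by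
    intro y r
    have hU : MeasurableSet (Metric.ball y r) := measurableSet_ball
    have hmU : m (Metric.ball y r) < ∞ := hm _ hU Metric.isBounded_ball
    have hbi := (hbar.integrableOn_toReal hq hmU).mul_const (lipConst f (Metric.ball y r))
    -- Test the representation with the indicator of `s ∩ B_r(y)`, a set on which the Lipschitz
    -- constant of the ball controls the signed variation.
    have hkey : ∀ s, MeasurableSet s → |∫ x in s, h x ∂m.restrict (Metric.ball y r)| ≤
        ∫ x in s, (bar π m x).toReal * lipConst f (Metric.ball y r)
          ∂m.restrict (Metric.ball y r) := by
      intro s hs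
      have hA := hs.inter hU
      have hg : MemLp ((s ∩ Metric.ball y r).indicator (1 : X → ℝ)) ∞ m :=
        (memLp_top_const (1 : ℝ)).indicator hA
      have h1 := hrep _ hg
      have h2 := abs_integral_signedVariation_le hπ hf Metric.isOpen_ball
        (lipschitzOnWith_lipConst hf (Metric.ball y r)) hA inter_subset_right
        (hbar.curveMeasure_lt_top hq hA ((measure_mono inter_subset_right).trans_lt hmU)).ne
      rw [← h1, hbar.curveMeasure_real hq hA, Real.coe_toNNReal _ (lipConst_nonneg _ _)] at h2
      rw [Measure.restrict_restrict hs, integral_mul_const, mul_comm]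
      refine le_trans (le_of_eq ?_) h2
      rw [← integral_indicator hA]
      congr 2
      funext x
      by_cases hx : x ∈ s ∩ Metric.ball y r <;> simp [hx]
    have h1 := ae_le_of_forall_setIntegral_le hh.restrict hbi
      fun s hs _ => (le_abs_self _).trans (hkey s hs)
    have h2 := ae_le_of_forall_setIntegral_le hh.restrict.neg hbi
      fun s hs _ => by
        simp only [Pi.neg_apply, integral_neg]
        exact (neg_le_abs _).trans (hkey s hs)
    have h3 : ∀ᵐ x ∂m.restrict (Metric.ball y r),
        |h x| ≤ (bar π m x).toReal * lipConst f (Metric.ball y r) := by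
      filter_upwards [h1, h2] with x h1 h2
      exact abs_le'.2 ⟨h1, h2⟩
    exact (ae_restrict_iff' hU).1 h3
  obtain ⟨S, hSc, hSd⟩ := TopologicalSpace.exists_countable_dense X
  have hall : ∀ᵐ x ∂m, ∀ y ∈ S, ∀ n : ℕ, x ∈ Metric.ball y (1 / ((n : ℝ) + 1)) →
      |h x| ≤ (bar π m x).toReal * lipConst f (Metric.ball y (1 / ((n : ℝ) + 1))) :=
    (ae_ball_iff hSc).2 fun y _ => ae_all_iff.2 fun n => hball y _
  filter_upwards [hall] with x hx
  exact le_mul_asympSlope_of_forall_ball hSd hf ENNReal.toReal_nonneg hx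

end Density

/-! ### The pairing of a plan with `f` and `g`. -/

section Linearity

variable {X : Type*} [MetricSpace X] [MeasurableSpace C(I, X)] {π : Measure C(I, X)}

/-- The pairing `∫ ∫ g ∘ γ dμ_{f ∘ γ} dπ(γ)`. -/
def planIntegral (π : Measure C(I, X)) (f g : X → ℝ) : ℝ :=
  ∫ γ, (∫ᵛ t, g (γ t) ∂•(signedVariation fun t => f (γ t))) ∂π

/-- Absolute convergence of the iterated integral defining `planIntegral`. -/
def PlanIntegrable (π : Measure C(I, X)) (f g : X → ℝ) : Prop :=
  (∀ᵐ γ ∂π, (signedVariation fun t => f (γ t)).Integrable fun t => g (γ t)) ∧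
    Integrable (fun γ : C(I, X) => ∫ᵛ t, g (γ t) ∂•(signedVariation fun t => f (γ t))) π

theorem planIntegral_add [IsFiniteMeasure π] (hπ : IsPlan π) (f₁ f₂ : LIPbs X) {g : X → ℝ}
    (h₁ : PlanIntegrable π f₁ g) (h₂ : PlanIntegrable π f₂ g) :
    planIntegral π ((f₁ + f₂ : LIPbs X) : X → ℝ) g =
      planIntegral π f₁ g + planIntegral π f₂ g := by
  obtain ⟨f₁, ⟨K, hf₁⟩, _⟩ := f₁
  obtain ⟨f₂, ⟨L, hf₂⟩, _⟩ := f₂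
  have hf : LipschitzWith (K + L) fun x => f₁ x + f₂ x := hf₁.add hf₂
  rw [planIntegral, planIntegral, planIntegral, ← integral_add h₁.2 h₂.2]
  refine integral_congr_ae ?_
  filter_upwards [hπ, h₁.1, h₂.1] with γ hγ i₁ i₂
  have hb := hγ.boundedVariationOn_comp hf
  have e := signedVariation_add (continuous_comp_curve hf₁ γ) (hγ.boundedVariationOn_comp hf₁)
    (continuous_comp_curve hf₂ γ) (hγ.boundedVariationOn_comp hf₂) hb
  rw [← VectorMeasure.integral_add_vectorMeasure i₁ i₂, ← e]
  rfl

/-- Unlike additivity, this needs no integrability: scaling is compatible with the default value `0`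
of the integrals. -/
theorem planIntegral_smul [IsFiniteMeasure π] (hπ : IsPlan π) (c : ℝ) (f : LIPbs X) (g : X → ℝ) :
    planIntegral π ((c • f : LIPbs X) : X → ℝ) g = c * planIntegral π f g := by
  obtain ⟨f, ⟨K, hf⟩, hb⟩ := f
  obtain ⟨⟨L, hcf⟩, -⟩ := (c • (⟨f, ⟨K, hf⟩, hb⟩ : LIPbs X)).2
  have hcf' : LipschitzWith L fun x => c * f x := hcf
  rw [planIntegral, planIntegral, ← integral_const_mul]
  refine integral_congr_ae ?_
  filter_upwards [hπ] with γ hγ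
  have hb := hγ.boundedVariationOn_comp hcf'
  have e := signedVariation_const_mul c (continuous_comp_curve hf γ)
    (hγ.boundedVariationOn_comp hf) hb
  rw [← smul_eq_mul, ← VectorMeasure.integral_smul_vectorMeasure, ← e]
  rfl

theorem planIntegral_one [IsFiniteMeasure π] (hπ : IsPlan π) (f : LIPbs X) :
    planIntegral π f (fun _ => 1) =
      ∫ γ : C(I, X), ((f : X → ℝ) (γ 1) - (f : X → ℝ) (γ 0)) ∂π := by
  obtain ⟨f, ⟨K, hf⟩, _⟩ := f
  refine integral_congr_ae ?_
  filter_upwards [hπ] with γ hγ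
  rw [VectorMeasure.integral_const, univ_eq_Icc_zero_one,
    signedVariation_Icc (continuous_comp_curve hf γ) (hγ.boundedVariationOn_comp hf)
      unitInterval.nonneg']
  simp

end Linearity

/-! ### Leibniz rule, uniqueness, and construction of the derivation. -/

section Derivation

theorem LIPbs.exists_bound {X : Type*} [MetricSpace X] (f : LIPbs X) :
    ∃ C, ∀ x, ‖(f : X → ℝ) x‖ ≤ C := by
  obtain ⟨⟨K, hf⟩, hb⟩ := f.2
  obtain ⟨C, hC⟩ := (hf.isBounded_image hb).exists_norm_le
  refine ⟨max C 0, fun x => ?_⟩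
  by_cases hx : (f : X → ℝ) x = 0
  · simp [hx]
  · exact (hC _ ⟨x, hx, rfl⟩).trans (le_max_left _ _)

variable {X : Type*} [MetricSpace X] [MeasurableSpace X]

theorem ae_eq_of_forall_integral_mul_eq {X : Type*} [MeasurableSpace X] {m : Measure X}
    {h h' : X → ℝ} (hh : Integrable h m) (hh' : Integrable h' m)
    (H : ∀ g : X → ℝ, MemLp g ∞ m → ∫ x, g x * h x ∂m = ∫ x, g x * h' x ∂m) : h =ᵐ[m] h' := by
  refine Integrable.ae_eq_of_forall_setIntegral_eq _ _ hh hh' fun s hs _ => ?_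
  have h1 := H _ ((memLp_top_const (1 : ℝ)).indicator hs)
  have e : ∀ (k : X → ℝ) x, s.indicator (fun _ => (1 : ℝ)) x * k x = s.indicator k x := by
    intro k x
    by_cases hx : x ∈ s <;> simp [hx]
  simp_rw [e] at h1
  rwa [integral_indicator hs, integral_indicator hs] at h1

/-- A linear map bounded by a multiple of the asymptotic slope is a derivation. -/
theorem leibniz_of_weak_locality {m : Measure X} {q : ℝ≥0∞} (T : LIPbs X →ₗ[ℝ] Lp ℝ q m)
    {G : X → ℝ} (hG : ∀ᵐ x ∂m, 0 ≤ G x)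
    (hT : ∀ f : LIPbs X, ∀ᵐ x ∂m, |T f x| ≤ G x * asympSlope f x) (f g : LIPbs X) :
    ∀ᵐ x ∂m, T (f * g) x = (f : X → ℝ) x * T g x + (g : X → ℝ) x * T f x := by
  obtain ⟨K, hf⟩ := f.2.1
  obtain ⟨L, hg⟩ := g.2.1
  -- This is `T` applied to `(f - c)(g - d) - c d`, expanded since nonzero constants may lack
  -- bounded support. Rational `c, d` give one common null set; continuity then allows `c = f x`, `d
  -- = g x`.
  have hcd : ∀ c d : ℚ, ∀ᵐ x ∂m, |T (f * g) x - c * T g x - d * T f x| ≤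
      G x * (|(f : X → ℝ) x - c| * L + |(g : X → ℝ) x - d| * K) := by
    intro c d
    have e : T (f * g - (c : ℝ) • g - (d : ℝ) • f) =
        T (f * g) - (c : ℝ) • T g - (d : ℝ) • T f := by
      rw [map_sub, map_sub, map_smul, map_smul]
    filter_upwards [hT (f * g - (c : ℝ) • g - (d : ℝ) • f), hG,
      Lp.coeFn_sub (T (f * g) - (c : ℝ) • T g) ((d : ℝ) • T f),
      Lp.coeFn_sub (T (f * g)) ((c : ℝ) • T g), Lp.coeFn_smul (c : ℝ) (T g),
      Lp.coeFn_smul (d : ℝ) (T f)] with x h1 h2 h3 h4 h5 h6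
    rw [e, h3, Pi.sub_apply, h4, Pi.sub_apply, h5, h6, Pi.smul_apply, Pi.smul_apply, smul_eq_mul,
      smul_eq_mul] at h1
    exact h1.trans (mul_le_mul_of_nonneg_left (asympSlope_mul_sub_le hf hg c d x) h2)
  have hall : ∀ᵐ x ∂m, ∀ c d : ℚ, |T (f * g) x - c * T g x - d * T f x| ≤
      G x * (|(f : X → ℝ) x - c| * L + |(g : X → ℝ) x - d| * K) :=
    ae_all_iff.2 fun c => ae_all_iff.2 fun d => hcd c d
  filter_upwards [hall] with x hx
  have hcl : IsClosed {p : ℝ × ℝ | |T (f * g) x - p.1 * T g x - p.2 * T f x| ≤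
      G x * (|(f : X → ℝ) x - p.1| * L + |(g : X → ℝ) x - p.2| * K)} :=
    isClosed_le (by fun_prop) (by fun_prop)
  have hdense : Dense (range (Prod.map ((↑) : ℚ → ℝ) ((↑) : ℚ → ℝ))) :=
    Rat.denseRange_cast.prodMap Rat.denseRange_cast
  have hsub : range (Prod.map ((↑) : ℚ → ℝ) ((↑) : ℚ → ℝ)) ⊆
      {p : ℝ × ℝ | |T (f * g) x - p.1 * T g x - p.2 * T f x| ≤
        G x * (|(f : X → ℝ) x - p.1| * L + |(g : X → ℝ) x - p.2| * K)} := by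
    rintro _ ⟨⟨c, d⟩, rfl⟩
    exact hx c d
  have h1 := hcl.closure_subset_iff.2 hsub (hdense ((f : X → ℝ) x, (g : X → ℝ) x))
  simp only [mem_ofPred_eq, sub_self, abs_zero, zero_mul, add_zero, mul_zero] at h1
  have h2 := abs_nonpos_iff.1 h1
  linarith

/-- `b(f)` vanishes off the bounded set `tsupport f`, where the slope is zero, and `L^q ⊆ L¹` on
that set. -/
theorem LipDerivation.integrable [BorelSpace X] {m : Measure X}
    (hm : ∀ B : Set X, MeasurableSet B → Bornology.IsBounded B → m B < ∞) {q : ℝ≥0∞}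
    (hq : 1 ≤ q) (b : LipDerivation m q) (f : LIPbs X) : Integrable (b.toLinearMap f) m := by
  obtain ⟨G, -, hG⟩ := b.weak_locality
  have hT : MeasurableSet (tsupport (f : X → ℝ)) := (isClosed_tsupport _).measurableSet
  have hfin : IsFiniteMeasure (m.restrict (tsupport (f : X → ℝ))) := ⟨by
    rw [Measure.restrict_apply_univ]
    exact hm _ hT f.2.2.closure⟩
  have h1 : IntegrableOn (b.toLinearMap f) (tsupport (f : X → ℝ)) m :=
    ((Lp.memLp (b.toLinearMap f)).restrict _).integrable hq
  refine (h1.integrable_indicator hT).congr ?_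
  filter_upwards [hG f] with x hx
  by_cases hxT : x ∈ tsupport (f : X → ℝ)
  · rw [indicator_of_mem hxT]
  · rw [asympSlope_eq_zero_of_notMem_tsupport hxT, mul_zero] at hx
    rw [indicator_of_notMem hxT, abs_nonpos_iff.1 hx]

variable [BorelSpace X]

theorem integral_ofSignedMeasure (ν : SignedMeasure X) (f : LIPbs X) :
    (BoundedlyFiniteSignedMeasure.ofSignedMeasure ν).integral f =
      ∫ᵛ x, (f : X → ℝ) x ∂•ν := by
  have hT : MeasurableSet (tsupport (f : X → ℝ)) := (isClosed_tsupport _).measurableSet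
  have hb : Bornology.IsBounded (tsupport (f : X → ℝ)) := f.2.2.closure
  have e : (BoundedlyFiniteSignedMeasure.ofSignedMeasure ν).trace (tsupport (f : X → ℝ)) =
      ν.restrict (tsupport (f : X → ℝ)) := by
    ext E hE
    rw [BoundedlyFiniteSignedMeasure.trace_apply _ hT hb hE, VectorMeasure.restrict_apply _ hT hE,
      inter_comm]
    exact if_pos ⟨hE.inter hT, hb.subset inter_subset_right⟩
  rw [BoundedlyFiniteSignedMeasure.integral, e, ← VectorMeasure.integral_indicator hT,
    indicator_eq_self.2 (subset_tsupport _)]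

theorem LipDerivation.ext_of_integral_mul_eq {m : Measure X}
    (hm : ∀ B : Set X, MeasurableSet B → Bornology.IsBounded B → m B < ∞) {q : ℝ≥0∞}
    (hq : 1 ≤ q)
    {b b' : LipDerivation m q} (h : ∀ (f : LIPbs X) (g : X → ℝ), MemLp g ∞ m →
      ∫ x, g x * b.toLinearMap f x ∂m = ∫ x, g x * b'.toLinearMap f x ∂m) : b = b' := by
  refine LipDerivation.ext (LinearMap.ext fun f => Lp.ext ?_)
  exact ae_eq_of_forall_integral_mul_eq (b.integrable hm hq f) (b'.integrable hm hq f) (h f)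

theorem LipDerivationDiv.div_eq_of_isDivergence {m : Measure X} {q : ℝ≥0∞}
    {b : LipDerivationDiv m q}
    {ν : BoundedlyFiniteSignedMeasure X} (h : b.IsDivergence ν) : b.div = ν := by
  refine BoundedlyFiniteSignedMeasure.ext_of_integral fun f => neg_injective ?_
  rw [← h f]
  exact (b.exists_divergence.choose_spec f).symm

variable [MeasurableSpace C(I, X)] [BorelSpace C(I, X)]
  {π : Measure C(I, X)} [IsFiniteMeasure π] {m : Measure X} {q : ℝ≥0∞}

theorem exists_lipDerivation [TopologicalSpace.SeparableSpace X]
    (hm : ∀ B : Set X, MeasurableSet B → Bornology.IsBounded B → m B < ∞) (hq : 1 < q)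
    (hπ : IsPlan π) (hbar : HasBarycenter π m q) :
    ∃ b : LipDerivation m q, hbar.memLp_toReal.toLp _ ∈ b.bounds ∧
      ∀ (f : LIPbs X) (g : X → ℝ), MemLp g ∞ m →
        ∫ x, g x * b.toLinearMap f x ∂m = planIntegral π f g := by
  have hint : ∀ (f : LIPbs X) (g : X → ℝ), MemLp g ∞ m → PlanIntegrable π f g :=
    fun f g hg => (exists_density hm hq hπ hbar f).1 g hg
  choose h hh hrep hle using fun f : LIPbs X => (exists_density hm hq hπ hbar f).2
  -- The slope is at most the global Lipschitz constant `K`, so `|h f| ≤ K Bar(π)`.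
  have hmem : ∀ f, MemLp (h f) q m := by
    intro f
    obtain ⟨K, hf⟩ := f.2.1
    refine hbar.memLp_toReal.of_le_mul (c := K) (hh f).1 ?_
    filter_upwards [hle f] with x hx
    rw [Real.norm_eq_abs, Real.norm_eq_abs, abs_of_nonneg ENNReal.toReal_nonneg, mul_comm]
    exact hx.trans (mul_le_mul_of_nonneg_left (asympSlope_le hf x) ENNReal.toReal_nonneg)
  have hbi : ∀ {g k : X → ℝ}, MemLp g ∞ m → Integrable k m → Integrable (fun x => g x * k x) m :=
    fun hg hk => hk.mul_of_top_right hg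
  let T : LIPbs X →ₗ[ℝ] Lp ℝ q m :=
    { toFun := fun f => (hmem f).toLp _
      map_add' := fun f₁ f₂ => by
        rw [← MemLp.toLp_add, MemLp.toLp_eq_toLp_iff]
        refine ae_eq_of_forall_integral_mul_eq (hh _) ((hh f₁).add (hh f₂)) fun g hg => ?_
        simp only [Pi.add_apply, mul_add]
        rw [integral_add (hbi hg (hh f₁)) (hbi hg (hh f₂)), hrep _ g hg, hrep _ g hg, hrep _ g hg]
        exact planIntegral_add hπ f₁ f₂ (hint f₁ g hg) (hint f₂ g hg)
      map_smul' := fun c f => by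
        rw [RingHom.id_apply, ← MemLp.toLp_const_smul, MemLp.toLp_eq_toLp_iff]
        refine ae_eq_of_forall_integral_mul_eq (hh _) ((hh f).smul c) fun g hg => ?_
        simp only [Pi.smul_apply, smul_eq_mul, mul_left_comm _ c]
        rw [integral_const_mul, hrep _ g hg, hrep _ g hg]
        exact planIntegral_smul hπ c f g }
  have hTh : ∀ f, T f =ᵐ[m] h f := fun f => (hmem f).coeFn_toLp
  have hG := hbar.memLp_toReal.coeFn_toLp
  have hG0 : ∀ᵐ x ∂m, 0 ≤ hbar.memLp_toReal.toLp _ x := by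
    filter_upwards [hG] with x hx
    rw [hx]
    exact ENNReal.toReal_nonneg
  have hTG : ∀ f : LIPbs X, ∀ᵐ x ∂m,
      |T f x| ≤ hbar.memLp_toReal.toLp _ x * asympSlope f x := by
    intro f
    filter_upwards [hTh f, hG, hle f] with x h1 h2 h3
    rwa [h1, h2]
  refine ⟨⟨T, ⟨_, (Lp.coeFn_nonneg _).1 hG0, hTG⟩, leibniz_of_weak_locality T hG0 hTG⟩,
    ⟨(Lp.coeFn_nonneg _).1 hG0, hTG⟩, fun f g hg => ?_⟩
  rw [planIntegral, ← hrep f g hg]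
  refine integral_congr_ae ?_
  filter_upwards [hTh f] with x hx
  exact congrArg (g x * ·) hx

theorem integral_lipbs_endpoints (π : Measure C(I, X)) [IsFiniteMeasure π] (f : LIPbs X) :
    ∫ γ : C(I, X), ((f : X → ℝ) (γ 1) - (f : X → ℝ) (γ 0)) ∂π =
      -(BoundedlyFiniteSignedMeasure.ofSignedMeasure ((π.map fun γ => γ 0).toSignedMeasure -
        (π.map fun γ => γ 1).toSignedMeasure)).integral f := by
  obtain ⟨K, hf⟩ := f.2.1
  obtain ⟨C, hC⟩ := LIPbs.exists_bound f
  have he : ∀ t : I, Measurable fun γ : C(I, X) => γ t := fun t =>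
    (continuous_eval_const t).measurable
  have hfi : ∀ (μ : Measure X) [IsFiniteMeasure μ], Integrable (f : X → ℝ) μ := fun μ _ =>
    Integrable.of_bound hf.continuous.measurable.aestronglyMeasurable C (Eventually.of_forall hC)
  have hfe : ∀ t : I, Integrable (fun γ : C(I, X) => (f : X → ℝ) (γ t)) π := fun t =>
    Integrable.of_bound (hf.continuous.measurable.comp (he t)).aestronglyMeasurable C
      (Eventually.of_forall fun γ => hC _)
  have hvi : ∀ (μ : Measure X) [IsFiniteMeasure μ],
      μ.toSignedMeasure.Integrable (f : X → ℝ) := fun μ _ => hfi _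
  rw [integral_ofSignedMeasure, VectorMeasure.integral_sub_vectorMeasure (hvi _) (hvi _),
    integral_lsmul_toSignedMeasure, integral_lsmul_toSignedMeasure,
    integral_map (he 0).aemeasurable hf.continuous.measurable.aestronglyMeasurable,
    integral_map (he 1).aemeasurable hf.continuous.measurable.aestronglyMeasurable,
    integral_sub (hfe 1) (hfe 0), neg_sub]

theorem LipDerivation.isDivergence_of_integral_mul_eq (hπ : IsPlan π) (b : LipDerivation m q)
    (hb : ∀ (f : LIPbs X) (g : X → ℝ), MemLp g ∞ m →
      ∫ x, g x * b.toLinearMap f x ∂m = planIntegral π f g) :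
    b.IsDivergence (BoundedlyFiniteSignedMeasure.ofSignedMeasure
      ((π.map fun γ => γ 0).toSignedMeasure - (π.map fun γ => γ 1).toSignedMeasure)) := by
  intro f
  have h1 := hb f (fun _ => 1) (memLp_top_const 1)
  rw [planIntegral_one hπ, integral_lipbs_endpoints] at h1
  simpa using h1

end Derivation

end MetricMeasure

end

theorem mainTheorem6 {X : Type*} [MetricSpace X] [CompleteSpace X]
    [TopologicalSpace.SeparableSpace X] [MeasurableSpace X] [BorelSpace X]
    [MeasurableSpace C(I, X)] [BorelSpace C(I, X)]
    (m : Measure X) (hm : ∀ B : Set X, MeasurableSet B → Bornology.IsBounded B → m B < ∞)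
    (q : ℝ≥0∞) (hq : 1 < q)
    (π : Measure C(I, X)) [IsFiniteMeasure π] (hπ : MetricMeasure.IsPlan π)
    (hbar : MetricMeasure.HasBarycenter π m q) :
    -- the iterated integrals below converge absolutely
    (∀ (f : MetricMeasure.LIPbs X) (g : X → ℝ), MemLp g ∞ m →
      (∀ᵐ γ ∂π, (MetricMeasure.signedVariation fun t => (f : X → ℝ) (γ t)).Integrable
        fun t => g (γ t)) ∧
      Integrable (fun γ : C(I, X) => ∫ᵛ t, g (γ t)
        ∂•(MetricMeasure.signedVariation fun t => (f : X → ℝ) (γ t))) π) ∧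
    -- existence and uniqueness of the induced derivation
    (∃! b : MetricMeasure.LipDerivationDiv m q, b.IsInducedBy π) ∧
    -- its pointwise norm and its divergence
    ∀ b : MetricMeasure.LipDerivationDiv m q, b.IsInducedBy π →
      (∃ N : Lp ℝ q m, b.IsPointwiseNorm N ∧
        ∀ᵐ x ∂m, ENNReal.ofReal (N x) ≤ MetricMeasure.bar π m x) ∧
      b.div = MetricMeasure.BoundedlyFiniteSignedMeasure.ofSignedMeasure
        ((π.map fun γ => γ 0).toSignedMeasure - (π.map fun γ => γ 1).toSignedMeasure) := by
  have hσ : SigmaFinite m := MetricMeasure.sigmaFinite_of_measure_lt_top_of_isBounded hm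
  obtain ⟨b₀, hb₀, hind⟩ := MetricMeasure.exists_lipDerivation hm hq hπ hbar
  have huniq : ∀ b : MetricMeasure.LipDerivationDiv m q, b.IsInducedBy π →
      b.toLipDerivation = b₀ := fun b hb =>
    MetricMeasure.LipDerivation.ext_of_integral_mul_eq hm hq.le fun f g hg =>
      (hb f g hg).trans (hind f g hg).symm
  have hdiv := b₀.isDivergence_of_integral_mul_eq hπ hind
  refine ⟨fun f g hg => (MetricMeasure.exists_density hm hq hπ hbar f).1 g hg,
    ⟨⟨b₀, _, hdiv⟩, hind, fun b hb => ?_⟩, fun b hb => ⟨?_, ?_⟩⟩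
  -- Having a divergence is a proposition, so equality of the underlying derivations is enough.
  · obtain ⟨b, hbd⟩ := b
    obtain rfl := huniq _ hb
    rfl
  · obtain ⟨N, hN⟩ := b₀.exists_isLeast_bounds
    refine ⟨N, ?_, ?_⟩
    · rw [MetricMeasure.LipDerivation.IsPointwiseNorm, huniq b hb]
      exact hN.isGLB
    · filter_upwards [(Lp.coeFn_le _ _).2 (hN.2 hb₀), hbar.memLp_toReal.coeFn_toLp] with x h1 h2
      rw [h2] at h1
      exact (ENNReal.ofReal_le_ofReal h1).trans ENNReal.ofReal_toReal_le
  · refine MetricMeasure.LipDerivationDiv.div_eq_of_isDivergence ?_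
    rw [huniq b hb]
    exact hdiv
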